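/- **Theorem 1 (Truncation Error Bound).** Let $\lambda>0$, $\eta>2$, $\sigma^2>0$, $T>0$, and let $1\le K\le N$ be integers. Let $\Phi\subset\mathbb{R}^2$ be a homogeneous Poisson point process of intensity $\lambda$, let $x_1,x_2,\dots$ be its points listed in order of increasing distance from the origin (almost surely $\|x_1\|<\|x_2\|<\cdots$), and put $R_i=\|x_i\|$, $r=R_1$ and $s=T r^{\eta}$. Let $g_1,g_2,\dots$ be i.i.d. $\mathrm{Exp}(1)$ random variables independent of $\Phi$. Define the coverage probability with infinitely many interferers $$P_{\mathrm{SG}}(T)=\mathbb{P}\left(\frac{g_1 r^{-\eta}}{\sum_{i\ge 2} g_i R_i^{-\eta}+\sigma^2}>T\right)$$ and the hybrid dominant-plus-tail approximation $$\widetilde P^{(N)}_{\mathrm{cov}}(T)=\mathbb{E}\left[e^{-s\sigma^2}\prod_{i=2}^{K}\mathbb{E}_{g_i\mid\Phi}\left[e^{-s g_i R_i^{-\eta}}\right]\exp\left(-2\pi\lambda\int_{R_K}^{R_N}\frac{s t^{-\eta}}{1+s t^{-\eta}}\,t\,dt\right)\right],$$ where $\mathbb{E}_{g_i\mid\Phi}$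 averages over $g_i\sim\mathrm{Exp}(1)$ with $\Phi$ held fixed, so that the $i$-th factor is $1/(1+sR_i^{-\eta})$. Let $$\delta_N(s,R_N)=1-\exp\left(-2\pi\lambda\int_{R_N}^{\infty}\frac{s t^{-\eta}}{1+s t^{-\eta}}\,t\,dt\right).$$ Then the integral defining $\delta_N(s,R_N)$ converges almost surely, $\delta_N(s,R_N)$ and the quantity averaged in $\widetilde P^{(N)}_{\mathrm{cov}}(T)$ are integrable, and $$\left|\widetilde P^{(N)}_{\mathrm{cov}}(T)-P_{\mathrm{SG}}(T)\right|\le \mathbb{E}_{r,R_N}\left[\delta_N(s,R_N)\right].$$ -/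

import Mathlib

open MeasureTheory ProbabilityTheory Set
open scoped ENNReal

noncomputable section

/-- The Euclidean plane `ℝ²`. -/
abbrev Plane : Type := EuclideanSpace ℝ (Fin 2)

/-- Number of points of the random set `Φ` lying in `A`. -/
def pointCount {Ω : Type*} (Φ : Ω → Set Plane) (A : Set Plane) (ω : Ω) : ℕ∞ :=
  (Φ ω ∩ A).encard

/-- The random set `Φ ⊆ ℝ²` is a homogeneous Poisson point process of intensity `lam`: the number
of points in a Borel set of finite area is Poisson with mean `lam` times the area, and the numbers
of points in finitely many pairwise disjoint Borel sets are independent. -/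
structure IsHomogeneousPPP {Ω : Type*} [MeasurableSpace Ω] (μ : Measure Ω) (lam : ℝ)
    (Φ : Ω → Set Plane) : Prop where
  measurable_count : ∀ A : Set Plane, MeasurableSet A → Measurable (pointCount Φ A)
  map_count : ∀ A : Set Plane, MeasurableSet A → volume A < ∞ →
    μ.map (pointCount Φ A) =
      (poissonMeasure (lam * (volume A).toReal).toNNReal).map (fun k : ℕ => (k : ℕ∞))
  indep_count : ∀ (n : ℕ) (A : Fin n → Set Plane), (∀ j, MeasurableSet (A j)) →
    Pairwise (fun j k => Disjoint (A j) (A k)) → iIndepFun (fun j => pointCount Φ (A j)) μ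

/-- `x i` (`i = 1, 2, …`) is the location of the `i`-th nearest point of `Φ` to the origin:
almost surely the distances are strictly increasing and the `x i` are exactly the points of `Φ`. -/
structure IsNearestEnumeration {Ω : Type*} [MeasurableSpace Ω] (μ : Measure Ω)
    (Φ : Ω → Set Plane) (x : ℕ+ → Ω → Plane) : Prop where
  measurable : ∀ i, Measurable (x i)
  strictMono : ∀ᵐ ω ∂μ, StrictMono (fun i => ‖x i ω‖)
  range_eq : ∀ᵐ ω ∂μ, range (fun i => x i ω) = Φ ω

/-- The powers `g i` are independent Rayleigh-fading gains, `g i ∼ Exp(1)`, and the whole family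
is independent of the base station locations `x`. -/
structure IsRayleighFading {Ω : Type*} [MeasurableSpace Ω] (μ : Measure Ω)
    (x : ℕ+ → Ω → Plane) (g : ℕ+ → Ω → ℝ) : Prop where
  measurable : ∀ i, Measurable (g i)
  map_eq : ∀ i, μ.map (g i) = expMeasure 1
  iIndep : iIndepFun g μ
  indep_locations : IndepFun (fun ω i => x i ω) (fun ω i => g i ω) μ

/-- Distance `R_i = ‖x_i‖` from the user at the origin to the `i`-th nearest base station;
`R_1 = r` is the serving distance. -/
def bsDist {Ω : Type*} (x : ℕ+ → Ω → Plane) (i : ℕ+) (ω : Ω) : ℝ := ‖x i ω‖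

/-- The variable `s = T r ^ η`. -/
def sVar {Ω : Type*} (x : ℕ+ → Ω → Plane) (η T : ℝ) (ω : Ω) : ℝ := T * bsDist x 1 ω ^ η

/-- Total interference from all base stations other than the serving one, as an extended
nonnegative number. -/
def interference {Ω : Type*} (x : ℕ+ → Ω → Plane) (g : ℕ+ → Ω → ℝ) (η : ℝ) (ω : Ω) : ℝ≥0∞ :=
  ∑' i : {i : ℕ+ // i ≠ 1}, ENNReal.ofReal (g i ω * bsDist x i ω ^ (-η))

/-- The SINR at the origin with infinitely many interferers. -/
def sinr {Ω : Type*} (x : ℕ+ → Ω → Plane) (g : ℕ+ → Ω → ℝ) (η σ : ℝ) (ω : Ω) : ℝ≥0∞ :=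
  ENNReal.ofReal (g 1 ω * bsDist x 1 ω ^ (-η)) /
    (interference x g η ω + ENNReal.ofReal (σ ^ 2))

/-- The infinite-interferer coverage probability `P_SG(T) = ℙ(SINR > T)`. -/
def coverageSG {Ω : Type*} [MeasurableSpace Ω] (μ : Measure Ω) (x : ℕ+ → Ω → Plane)
    (g : ℕ+ → Ω → ℝ) (η σ T : ℝ) : ℝ :=
  (μ {ω | ENNReal.ofReal T < sinr x g η σ ω}).toReal

/-- The function `t ↦ s t ^ (-η) / (1 + s t ^ (-η)) * t` integrated in the tail terms. -/
def tailKernel (η s t : ℝ) : ℝ := s * t ^ (-η) / (1 + s * t ^ (-η)) * t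

/-- The quantity averaged in the hybrid approximation: the noise term, the `K - 1` dominant
interferers averaged over their `Exp(1)` gains with the geometry held fixed, and the Laplace
functional of the interferers between the distances `R_K` and `R_N`. -/
def hybridIntegrand {Ω : Type*} (x : ℕ+ → Ω → Plane) (lam η σ T : ℝ) (K N : ℕ+) (ω : Ω) : ℝ :=
  Real.exp (-(sVar x η T ω * σ ^ 2)) *
    (∏ i ∈ Finset.Icc 2 K,
      ∫ u, Real.exp (-(sVar x η T ω * (u * bsDist x i ω ^ (-η)))) ∂(expMeasure 1)) *
    Real.exp (-(2 * Real.pi * lam *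
      ∫ t in (bsDist x K ω)..(bsDist x N ω), tailKernel η (sVar x η T ω) t))

/-- The hybrid dominant-plus-tail approximation of the coverage probability. -/
def coverageHybrid {Ω : Type*} [MeasurableSpace Ω] (μ : Measure Ω) (x : ℕ+ → Ω → Plane)
    (lam η σ T : ℝ) (K N : ℕ+) : ℝ :=
  ∫ ω, hybridIntegrand x lam η σ T K N ω ∂μ

/-- The tail error `δ(s, ρ) = 1 - exp (-2πλ ∫_ρ^∞ s t^(-η) / (1 + s t^(-η)) t dt)`. -/
def tailError (lam η s ρ : ℝ) : ℝ :=
  1 - Real.exp (-(2 * Real.pi * lam * ∫ t in Ioi ρ, tailKernel η s t))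

end

open Filter Topology

/-! Write D_n for the noise term times the factors 1/(1 + s R_i^(-η)) with 2 ≤ i ≤ n, M_n for the
tail mass beyond R_n, and C_n = D_n exp(-M_n). The core is the identity P_SG = E[C_K] for every K
(`coverageSG_eq_integral`). Given it, the hybrid integrand is almost surely Q = D_K exp(-(M_K -
M_N)), so C_K = Q exp(-M_N) and Q - C_K = Q δ_N. Since 0 ≤ Q ≤ 1 almost surely, the bound follows on
integrating.

The identity has two halves. First, E[C_n] does not depend on n
(`lintegral_conditionalCoverage_add_one`). In the coordinate λπ‖z‖² the ordered points form a
unit-rate Poisson process on the half-line: the next gap is Exp(1) and independent of the nearer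
points (`map_past_gap_eq_prod`). Averaging over that gap reproduces the exponential of the tail
mass, by an exact antiderivative (`lintegral_exp_neg_tailMass_step`). This replaces any appeal to
the Laplace functional of a Poisson process.

Second, E[D_n] tends to P_SG (`tendsto_lintegral_dominantFactor`): averaging out g_1 turns coverage
into an exponential of the interference, which is the limit of its finite truncations, and averaging
out the other gains gives D_n. As R_n tends to infinity almost surely, D_n - C_n tends to 0, so the
constant E[C_n] equals P_SG. -/

instance isProbabilityMeasure_expMeasure_one : IsProbabilityMeasure (expMeasure 1) :=
  isProbabilityMeasure_expMeasure one_pos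

/-! ### Integrals against the exponential law. -/

section ExponentialLaw

theorem lintegral_expMeasure_one {f : ℝ → ℝ≥0∞} :
    ∫⁻ u, f u ∂(expMeasure 1) = ∫⁻ u in Ioi 0, ENNReal.ofReal (Real.exp (-u)) * f u := by
  have hmeas : Measurable (exponentialPDF 1) :=
    (measurable_exponentialPDFReal 1).ennreal_ofReal
  have hdens : expMeasure 1 = volume.withDensity (exponentialPDF 1) := rfl
  rw [hdens, lintegral_withDensity_eq_lintegral_mul_non_measurable _ hmeas
    (ae_of_all _ fun u => by simp [exponentialPDF_eq])]
  rw [← lintegral_indicator measurableSet_Ioi]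
  -- The density is nonzero at 0, which the open half-line omits; the two integrands differ only
  -- there.
  have hne : ∀ᵐ u : ℝ, u ≠ 0 := by simp [ae_iff, measure_singleton]
  refine lintegral_congr_ae ?_
  filter_upwards [hne] with u hu
  rcases lt_or_gt_of_ne hu with h | h
  · simp [exponentialPDF_eq, h.not_ge, h.le]
  · simp [exponentialPDF_eq, h, h.le]

/-- The fundamental theorem of calculus against the exponential law. -/
theorem lintegral_expMeasure_one_of_hasDerivAt {F f : ℝ → ℝ}
    (hF : ∀ u ∈ Ici (0 : ℝ), HasDerivAt F (Real.exp (-u) * f u) u)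
    (hf : ∀ u ∈ Ioi (0 : ℝ), 0 ≤ f u) (hlim : Tendsto F atTop (𝓝 0)) :
    ∫⁻ u, ENNReal.ofReal (f u) ∂(expMeasure 1) = ENNReal.ofReal (-F 0) := by
  have hpos : ∀ u ∈ Ioi (0 : ℝ), 0 ≤ Real.exp (-u) * f u := fun u hu =>
    mul_nonneg (Real.exp_pos _).le (hf u hu)
  have hint : IntegrableOn (fun u => Real.exp (-u) * f u) (Ioi 0) :=
    integrableOn_Ioi_deriv_of_nonneg (hF 0 self_mem_Ici).continuousAt.continuousWithinAt
      (fun u hu => hF u (Ioi_subset_Ici_self hu)) hpos hlim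
  have hval := integral_Ioi_of_hasDerivAt_of_nonneg' hF hpos hlim
  rw [lintegral_expMeasure_one, ← zero_sub, ← hval,
    ofReal_integral_eq_lintegral_ofReal hint
      ((ae_restrict_iff' measurableSet_Ioi).2 (ae_of_all _ hpos))]
  simp_rw [ENNReal.ofReal_mul (Real.exp_pos _).le]

theorem lintegral_exp_neg_mul_expMeasure_one {c : ℝ} (hc : 0 ≤ c) :
    ∫⁻ u, ENNReal.ofReal (Real.exp (-(c * u))) ∂(expMeasure 1) =
      ENNReal.ofReal (1 / (1 + c)) := by
  have h1 : 0 < 1 + c := by linarith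
  rw [lintegral_expMeasure_one_of_hasDerivAt
    (F := fun u => -(1 / (1 + c)) * Real.exp (-((1 + c) * u)))]
  · simp
  · intro u _
    have h : HasDerivAt (fun u : ℝ => -((1 + c) * u)) (-((1 + c) * 1)) u :=
      ((hasDerivAt_id u).const_mul (1 + c)).neg
    refine (h.exp.const_mul (-(1 / (1 + c)))).congr_deriv ?_
    rw [← Real.exp_add]
    field_simp
    ring_nf
  · exact fun u _ => (Real.exp_pos _).le
  · have h : Tendsto (fun u : ℝ => (1 + c) * u) atTop atTop := tendsto_id.const_mul_atTop h1
    simpa using (Real.tendsto_exp_neg_atTop_nhds_zero.comp h).const_mul (-(1 / (1 + c)))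

theorem integral_exp_neg_mul_expMeasure_one {c : ℝ} (hc : 0 ≤ c) :
    ∫ u, Real.exp (-(c * u)) ∂(expMeasure 1) = 1 / (1 + c) := by
  rw [integral_eq_lintegral_of_nonneg_ae (ae_of_all _ fun u => (Real.exp_pos _).le)
    (by fun_prop), lintegral_exp_neg_mul_expMeasure_one hc, ENNReal.toReal_ofReal (by positivity)]

theorem expMeasure_one_Ioi {c : ℝ} (hc : 0 ≤ c) :
    expMeasure 1 (Ioi c) = ENNReal.ofReal (Real.exp (-c)) := by
  have h := cdf_expMeasure_eq one_pos c
  rw [if_pos hc, one_mul, cdf_eq_real] at h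
  have h2 := probReal_compl_eq_one_sub (μ := expMeasure 1) (measurableSet_Iic (a := c))
  rw [compl_Iic, h] at h2
  rw [← ofReal_measureReal, h2]
  congr 1
  ring

theorem ae_expMeasure_one_nonneg : ∀ᵐ u ∂(expMeasure 1), 0 ≤ u := by
  have h : expMeasure 1 (Iio 0) = 0 := by
    rw [← lintegral_indicator_one measurableSet_Iio, lintegral_expMeasure_one,
      setLIntegral_eq_zero_iff measurableSet_Ioi (by measurability)]
    refine ae_of_all _ fun u hu => ?_
    simp [(show (0 : ℝ) < u from hu).le]
  rw [ae_iff]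
  convert h using 2
  ext u
  simp

end ExponentialLaw

/-! ### The tail mass as a function of the radius. -/

section TailMass

/-- The mean mass `2πλ ∫_ρ^∞ s t^(-η) / (1 + s t^(-η)) t dt` of the points farther than `ρ`. -/
noncomputable def tailMass (lam η s ρ : ℝ) : ℝ :=
  2 * Real.pi * lam * ∫ t in Ioi ρ, tailKernel η s t

variable {lam η s ρ : ℝ}

theorem tailError_eq : tailError lam η s ρ = 1 - Real.exp (-tailMass lam η s ρ) := rfl

theorem tailKernel_nonneg (hs : 0 ≤ s) {t : ℝ} (ht : 0 ≤ t) : 0 ≤ tailKernel η s t := by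
  have := Real.rpow_nonneg ht (-η)
  unfold tailKernel
  positivity

theorem tailKernel_le (hs : 0 ≤ s) {t : ℝ} (ht : 0 < t) :
    tailKernel η s t ≤ s * t ^ (1 - η) := by
  have h := Real.rpow_pos_of_pos ht (-η)
  have h1 : s * t ^ (-η) / (1 + s * t ^ (-η)) ≤ s * t ^ (-η) :=
    div_le_self (by positivity) (by nlinarith)
  calc tailKernel η s t ≤ s * t ^ (-η) * t := mul_le_mul_of_nonneg_right h1 ht.le
    _ = s * t ^ (1 - η) := by
      rw [show 1 - η = -η + 1 by ring, Real.rpow_add_one ht.ne', mul_assoc]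

theorem continuousAt_tailKernel (hs : 0 ≤ s) {t : ℝ} (ht : 0 < t) :
    ContinuousAt (tailKernel η s) t := by
  have h := Real.rpow_pos_of_pos ht (-η)
  have h1 : ContinuousAt (fun t : ℝ => t ^ (-η)) t :=
    Real.continuousAt_rpow_const _ _ (Or.inl ht.ne')
  unfold tailKernel
  refine ContinuousAt.mul (ContinuousAt.div (by fun_prop) (by fun_prop) ?_) continuousAt_id
  positivity

theorem measurable_tailKernel_uncurry : Measurable fun p : ℝ × ℝ => tailKernel η p.1 p.2 := by
  unfold tailKernel
  fun_prop

/-- Domination by s t^(1-η): the exponent is below -1 exactly because η > 2, and ρ > 0 avoids the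
singularity of the bound at 0. -/
theorem integrableOn_tailKernel (hη : 2 < η) (hs : 0 ≤ s) (hρ : 0 < ρ) :
    IntegrableOn (tailKernel η s) (Ioi ρ) := by
  have h := (integrableOn_Ioi_rpow_of_lt (a := 1 - η) (by linarith) hρ).const_mul s
  refine h.mono' (by unfold tailKernel; fun_prop) ?_
  refine (ae_restrict_iff' measurableSet_Ioi).2 (ae_of_all _ fun t ht => ?_)
  have ht0 : 0 < t := hρ.trans ht
  rw [Real.norm_of_nonneg (tailKernel_nonneg hs ht0.le)]
  exact tailKernel_le hs ht0

theorem tailMass_nonneg (hlam : 0 ≤ lam) (hs : 0 ≤ s) (hρ : 0 ≤ ρ) :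
    0 ≤ tailMass lam η s ρ := by
  refine mul_nonneg (by positivity) (setIntegral_nonneg measurableSet_Ioi fun t ht => ?_)
  exact tailKernel_nonneg hs (hρ.trans (le_of_lt ht))

theorem tailMass_sub (hη : 2 < η) (hs : 0 ≤ s) {a b : ℝ} (ha : 0 < a) (hb : 0 < b) :
    tailMass lam η s a - tailMass lam η s b =
      2 * Real.pi * lam * ∫ t in a..b, tailKernel η s t := by
  rw [tailMass, tailMass, ← mul_sub, intervalIntegral.integral_Ioi_sub_Ioi'
    (integrableOn_tailKernel hη hs ha) (integrableOn_tailKernel hη hs hb)]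

theorem tailMass_anti (hlam : 0 ≤ lam) (hη : 2 < η) {s a b : ℝ} (hs : 0 ≤ s) (ha : 0 < a)
    (hab : a ≤ b) : tailMass lam η s b ≤ tailMass lam η s a := by
  rw [← sub_nonneg, tailMass_sub hη hs ha (ha.trans_le hab)]
  have := Real.pi_pos
  exact mul_nonneg (by positivity) (intervalIntegral.integral_nonneg hab fun t ht =>
    tailKernel_nonneg hs (ha.le.trans ht.1))

theorem hasDerivAt_tailMass (hη : 2 < η) (hs : 0 ≤ s) (hρ : 0 < ρ) :
    HasDerivAt (tailMass lam η s) (-(2 * Real.pi * lam * tailKernel η s ρ)) ρ := by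
  have hint : IntervalIntegrable (tailKernel η s) volume ρ ρ := by simp
  have hd : HasDerivAt (fun b => ∫ t in ρ..b, tailKernel η s t) (tailKernel η s ρ) ρ := by
    refine intervalIntegral.integral_hasDerivAt_right hint ?_ (continuousAt_tailKernel hs hρ)
    exact ⟨univ, univ_mem, by unfold tailKernel; fun_prop⟩
  refine ((hd.const_mul (2 * Real.pi * lam)).const_sub (tailMass lam η s ρ)).congr_of_eventuallyEq ?_
  filter_upwards [lt_mem_nhds hρ] with b hb
  rw [← tailMass_sub hη hs hρ hb]
  ring

theorem tendsto_tailMass_atTop (hη : 2 < η) (hs : 0 ≤ s) :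
    Tendsto (tailMass lam η s) atTop (𝓝 0) := by
  have h := (intervalIntegral_tendsto_integral_Ioi 1
    (integrableOn_tailKernel hη hs one_pos) tendsto_id).const_mul (2 * Real.pi * lam)
  have h2 := h.const_sub (tailMass lam η s 1)
  rw [← tailMass, sub_self] at h2
  refine h2.congr' ?_
  filter_upwards [eventually_gt_atTop 0] with b hb
  rw [id, ← tailMass_sub hη hs one_pos hb]
  ring

theorem measurable_tailMass_uncurry :
    Measurable fun p : ℝ × ℝ => tailMass lam η p.1 p.2 := by
  -- Both s and ρ will be random, so joint measurability is needed; an indicator moves the varying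
  -- domain into the integrand.
  have h : StronglyMeasurable fun q : (ℝ × ℝ) × ℝ =>
      (Ioi q.1.2).indicator (tailKernel η q.1.1) q.2 := by
    have hk : Measurable fun q : (ℝ × ℝ) × ℝ => tailKernel η q.1.1 q.2 :=
      measurable_tailKernel_uncurry.comp (by fun_prop : Measurable fun q : (ℝ × ℝ) × ℝ => (q.1.1, q.2))
    have hset : MeasurableSet {q : (ℝ × ℝ) × ℝ | q.1.2 < q.2} :=
      measurableSet_lt (by fun_prop) (by fun_prop)
    exact (hk.indicator hset).stronglyMeasurable
  have h2 := (h.integral_prod_right' (ν := volume)).measurable.const_mul (2 * Real.pi * lam)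
  simpa only [tailMass, integral_indicator measurableSet_Ioi] using h2

/-- Conditioning on the next point: if the area between consecutive circles, multiplied by the
intensity, is exponentially distributed, then the Laplace functional of the exterior of a disc
reproduces itself. -/
theorem lintegral_exp_neg_tailMass_step (hlam : 0 < lam) (hη : 2 < η) (hs : 0 ≤ s) (hρ : 0 < ρ) :
    ∫⁻ u, ENNReal.ofReal (1 / (1 + s * √(ρ ^ 2 + u / (lam * Real.pi)) ^ (-η)) *
        Real.exp (-tailMass lam η s √(ρ ^ 2 + u / (lam * Real.pi)))) ∂(expMeasure 1) =
      ENNReal.ofReal (Real.exp (-tailMass lam η s ρ)) := by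
  have hpi := Real.pi_pos
  have hk : 0 < lam * Real.pi := by positivity
  have hq : ∀ u ∈ Ici (0 : ℝ), 0 < ρ ^ 2 + u / (lam * Real.pi) := fun u hu => by
    have : 0 ≤ u / (lam * Real.pi) := div_nonneg hu hk.le
    positivity
  -- With r = √(ρ² + u/(λπ)) one has dr/du = 1/(2πλr), so the tail mass has u-derivative -s
  -- r^(-η)/(1 + s r^(-η)). Differentiating this F therefore produces the factor 1 - s r^(-η)/(1 + s
  -- r^(-η)) = 1/(1 + s r^(-η)).
  rw [lintegral_expMeasure_one_of_hasDerivAt (F := fun u => -(Real.exp (-u) *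
    Real.exp (-tailMass lam η s √(ρ ^ 2 + u / (lam * Real.pi)))))]
  · simp [Real.sqrt_sq hρ.le]
  · intro u hu
    have hq0 := hq u hu
    have hr : 0 < √(ρ ^ 2 + u / (lam * Real.pi)) := Real.sqrt_pos.2 hq0
    have h1 : HasDerivAt (fun u => ρ ^ 2 + u / (lam * Real.pi)) (1 / (lam * Real.pi)) u :=
      ((hasDerivAt_id u).div_const _).const_add _
    have h2 := h1.sqrt hq0.ne'
    have h3 := ((hasDerivAt_tailMass (lam := lam) hη hs hr).comp u h2).neg.exp
    have h4 := ((hasDerivAt_id u).neg.exp.mul h3).neg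
    refine h4.congr_deriv ?_
    have hp := Real.rpow_pos_of_pos hr (-η)
    simp only [Function.comp_apply, id, tailKernel, Pi.neg_apply]
    set r := √(ρ ^ 2 + u / (lam * Real.pi))
    set E := Real.exp (-tailMass lam η s r)
    have h5 : 1 + s * r ^ (-η) ≠ 0 := by positivity
    field_simp
    ring
  · intro u hu
    have := Real.rpow_nonneg (Real.sqrt_nonneg (ρ ^ 2 + u / (lam * Real.pi))) (-η)
    positivity
  · rw [← neg_zero]
    refine Tendsto.neg (squeeze_zero' (Eventually.of_forall fun u => by positivity) ?_
      Real.tendsto_exp_neg_atTop_nhds_zero)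
    refine Eventually.of_forall fun u => mul_le_of_le_one_right (Real.exp_pos _).le ?_
    rw [Real.exp_le_one_iff, neg_nonpos]
    exact tailMass_nonneg hlam.le hs (Real.sqrt_nonneg _)

end TailMass

/-! ### Discs and annuli measured by their Poisson mass; independence of counts. -/

section PoissonProcess

/-- `lam` times the area of the disc about the origin with `z` on its boundary. -/
noncomputable def discMass (lam : ℝ) (z : Plane) : ℝ := lam * Real.pi * ‖z‖ ^ 2

/-- The closed disc of mass `a`. -/
def massDisc (lam a : ℝ) : Set Plane := {z | discMass lam z ≤ a}

/-- The annulus between the discs of masses `a` and `b`. -/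
def massAnnulus (lam a b : ℝ) : Set Plane := {z | a < discMass lam z ∧ discMass lam z ≤ b}

variable {lam : ℝ}

@[fun_prop]
theorem measurable_discMass : Measurable (discMass lam) := by
  unfold discMass
  fun_prop

theorem discMass_nonneg (hlam : 0 ≤ lam) (z : Plane) : 0 ≤ discMass lam z := by
  have := Real.pi_pos
  unfold discMass
  positivity

theorem discMass_lt_iff (hlam : 0 < lam) {z w : Plane} :
    discMass lam z < discMass lam w ↔ ‖z‖ < ‖w‖ := by
  have hk : 0 < lam * Real.pi := mul_pos hlam Real.pi_pos
  rw [discMass, discMass, mul_lt_mul_iff_right₀ hk,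
    sq_lt_sq₀ (norm_nonneg _) (norm_nonneg _)]

theorem measurableSet_massDisc {a : ℝ} : MeasurableSet (massDisc lam a) :=
  measurableSet_le measurable_discMass measurable_const

theorem measurableSet_massAnnulus {a b : ℝ} : MeasurableSet (massAnnulus lam a b) :=
  (measurableSet_lt measurable_const measurable_discMass).inter
    (measurableSet_le measurable_discMass measurable_const)

theorem volume_massDisc (hlam : 0 < lam) {a : ℝ} (ha : 0 ≤ a) :
    volume (massDisc lam a) = ENNReal.ofReal (a / lam) := by
  have hpi := Real.pi_pos
  have hk : 0 < lam * Real.pi := by positivity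
  have h : massDisc lam a = Metric.closedBall 0 √(a / (lam * Real.pi)) := by
    ext z
    rw [massDisc, mem_ofPred_eq, mem_closedBall_zero_iff, Real.le_sqrt (norm_nonneg _)
      (by positivity), le_div_iff₀ hk, discMass, mul_comm]
  rw [h, EuclideanSpace.volume_closedBall_fin_two, ← ENNReal.ofReal_pow (Real.sqrt_nonneg _),
    Real.sq_sqrt (by positivity), ← ENNReal.ofReal_mul (by positivity)]
  congr 1
  field_simp

theorem volume_massAnnulus (hlam : 0 < lam) {a b : ℝ} (ha : 0 ≤ a) (hab : a ≤ b) :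
    volume (massAnnulus lam a b) = ENNReal.ofReal ((b - a) / lam) := by
  have h : massAnnulus lam a b = massDisc lam b \ massDisc lam a := by
    ext z
    simp [massAnnulus, massDisc, and_comm]
  have hsub : massDisc lam a ⊆ massDisc lam b := fun z hz => le_trans hz hab
  rw [h, measure_sdiff hsub measurableSet_massDisc.nullMeasurableSet
    (by rw [volume_massDisc hlam ha]; exact ENNReal.ofReal_ne_top),
    volume_massDisc hlam ha, volume_massDisc hlam (ha.trans hab),
    ← ENNReal.ofReal_sub _ (by positivity), sub_div]

variable {Ω : Type*} [MeasurableSpace Ω] {μ : Measure Ω} {Φ : Ω → Set Plane}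

theorem IsHomogeneousPPP.measure_count_eq_zero (hΦ : IsHomogeneousPPP μ lam Φ) {A : Set Plane}
    (hA : MeasurableSet A) (hfin : volume A < ∞) (hlam : 0 ≤ lam) :
    μ {ω | pointCount Φ A ω = 0} = ENNReal.ofReal (Real.exp (-(lam * (volume A).toReal))) := by
  have h1 : {ω | pointCount Φ A ω = 0} = pointCount Φ A ⁻¹' {0} := rfl
  have h2 : (fun k : ℕ => (k : ℕ∞)) ⁻¹' {0} = {0} := by ext; simp
  rw [h1, ← Measure.map_apply (hΦ.measurable_count A hA) (measurableSet_singleton _),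
    hΦ.map_count A hA hfin, Measure.map_apply (measurable_from_top) (measurableSet_singleton _),
    h2, poissonMeasure_singleton, Real.coe_toNNReal _ (by positivity)]
  simp

theorem IsHomogeneousPPP.ae_count_ne_top (hΦ : IsHomogeneousPPP μ lam Φ) {A : Set Plane}
    (hA : MeasurableSet A) (hfin : volume A < ∞) : ∀ᵐ ω ∂μ, pointCount Φ A ω ≠ ⊤ := by
  have h2 : (fun k : ℕ => (k : ℕ∞)) ⁻¹' {⊤} = ∅ := by ext; simp
  have h : μ (pointCount Φ A ⁻¹' {⊤}) = 0 := by
    rw [← Measure.map_apply (hΦ.measurable_count A hA) (measurableSet_singleton _),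
      hΦ.map_count A hA hfin, Measure.map_apply (measurable_from_top) (measurableSet_singleton _),
      h2, measure_empty]
  rw [ae_iff]
  convert h using 2
  ext ω
  simp

/-- Counts in arbitrary sets are jointly independent of the count in a set disjoint from them. -/
theorem IsHomogeneousPPP.indepFun_count (hΦ : IsHomogeneousPPP μ lam Φ) {ι : Type*} [Finite ι]
    {A : ι → Set Plane} {B : Set Plane} (hA : ∀ i, MeasurableSet (A i)) (hB : MeasurableSet B)
    (hAB : ∀ i, Disjoint (A i) B) :
    IndepFun (fun ω i => pointCount Φ (A i) ω) (pointCount Φ B) μ := by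
  classical
  have : Fintype ι := Fintype.ofFinite ι
  -- The hypothesis gives independence only for disjoint sets, so the possibly overlapping A i are
  -- cut into atoms: `some s` is the part outside B lying in exactly the A i with i in s, and `none`
  -- is B.
  let atom : Option (Set ι) → Set Plane := fun o =>
    o.elim B fun s => {z | ∀ i, z ∈ A i ↔ i ∈ s} \ B
  have hmeas : ∀ o, MeasurableSet (atom o) := by
    rintro (_ | s)
    · exact hB
    · refine MeasurableSet.diff ?_ hB
      rw [ofPred_forall]
      refine MeasurableSet.iInter fun i => ?_
      by_cases hi : i ∈ s
      · simpa [hi] using hA i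
      · convert (hA i).compl using 1
        ext z
        simp [hi]
  have hdisj : Pairwise fun o p => Disjoint (atom o) (atom p) := by
    rintro (_ | s) (_ | t) hst
    · exact absurd rfl hst
    · exact disjoint_sdiff_self_right
    · exact disjoint_sdiff_self_left
    · refine Set.disjoint_left.2 fun z hz hz' => hst ?_
      congr 1
      ext i
      exact (hz.1 i).symm.trans (hz'.1 i)
  let e := Fintype.equivFin (Option (Set ι))
  have hind : iIndepFun (fun o => pointCount Φ (atom o)) μ := by
    have h := (hΦ.indep_count _ (fun j => atom (e.symm j)) (fun j => hmeas _)
      (fun j k hjk => hdisj (e.symm.injective.ne hjk))).precomp e.injective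
    simpa using h
  let S : Finset (Option (Set ι)) := Finset.univ.erase none
  let emb (s : Set ι) : S := ⟨some s, by simp [S]⟩
  have hST : Disjoint S {none} := by simp [S]
  let φ : (S → ℕ∞) → ι → ℕ∞ := fun v i => ∑ s : {s : Set ι // i ∈ s}, v (emb s.1)
  have hφ : Measurable φ := measurable_pi_lambda _ fun i =>
    Finset.measurable_fun_sum _ fun s _ => measurable_pi_apply (emb s.1)
  have h := (hind.indepFun_finset S {none} hST (fun o => hΦ.measurable_count _ (hmeas o))).comp
    hφ (measurable_pi_apply ⟨none, by simp⟩)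
  refine h.congr (.of_eq ?_) (.of_eq rfl)
  ext ω i
  -- Removing B from the atoms loses nothing here, because A i is disjoint from B.
  have hU : Φ ω ∩ A i = ⋃ s : {s : Set ι // i ∈ s}, Φ ω ∩ atom (some s.1) := by
    ext z
    simp only [mem_inter_iff, mem_iUnion, exists_and_left]
    refine and_congr_right fun _ => ⟨fun hz => ?_, ?_⟩
    · exact ⟨⟨{j | z ∈ A j}, hz⟩, fun j => Iff.rfl, Set.disjoint_left.1 (hAB i) hz⟩
    · rintro ⟨s, hs, -⟩
      exact (hs i).2 s.2
  have hd : Pairwise (Function.onFun Disjoint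
      fun s : {s : Set ι // i ∈ s} => Φ ω ∩ atom (some s.1)) := by
    intro s t hst
    refine (hdisj (i := some s.1) (j := some t.1) ?_).mono inter_subset_right inter_subset_right
    exact fun h => hst (Subtype.ext (Option.some_injective _ h))
  simp only [pointCount, Function.comp_apply, φ, emb]
  rw [hU, encard_iUnion_of_finite hd, finsum_eq_sum_of_fintype]

end PoissonProcess

/-! ### Positions of the ordered points in terms of counts. -/

section OrderedPoints

variable {Ω : Type*} [MeasurableSpace Ω] {μ : Measure Ω} {lam : ℝ} {Φ : Ω → Set Plane}
  {x : ℕ+ → Ω → Plane}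

theorem encard_setOf_le_pnat (i : ℕ+) : {j : ℕ+ | j ≤ i}.encard = (i : ℕ) := by
  have h : {j : ℕ+ | j ≤ i} = Finset.Icc 1 i := by
    ext j
    simp
  rw [h, encard_coe_eq_coe_finsetCard, PNat.card_Icc]
  simp

/-- The `i`-th nearest point lies within the disc of mass `a` iff that disc has `i` points. -/
theorem le_encard_massDisc_iff (hlam : 0 < lam) {y : ℕ+ → Plane} {S : Set Plane}
    (hmono : StrictMono fun i => ‖y i‖) (hrange : range y = S) (i : ℕ+) (a : ℝ) :
    ((i : ℕ) : ℕ∞) ≤ (S ∩ massDisc lam a).encard ↔ discMass lam (y i) ≤ a := by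
  have hinj : Function.Injective y := fun j k h => hmono.injective (congrArg norm h)
  have hS : S ∩ massDisc lam a = y '' {j | discMass lam (y j) ≤ a} := by
    rw [← hrange, ← image_univ, ← image_inter_preimage, univ_inter]
    rfl
  rw [hS, hinj.encard_image]
  have hle : ∀ {j k}, j ≤ k → discMass lam (y j) ≤ discMass lam (y k) := fun {j k} h =>
    h.eq_or_lt.elim (fun h => by rw [h]) fun h => ((discMass_lt_iff hlam).2 (hmono h)).le
  constructor
  · intro h
    by_contra! hi
    -- Only indices below i can lie in the disc, and adjoining i keeps them within an i-element set,
    -- so there are at most i - 1 of them.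
    have hsub : insert i {j | discMass lam (y j) ≤ a} ⊆ {j | j ≤ i} := by
      rintro j (rfl | hj)
      · exact le_refl j
      · refine not_lt.1 fun (hij : i < j) => ?_
        exact absurd (lt_of_lt_of_le hi (hle hij.le)) (not_lt.2 hj)
    have h2 := encard_le_encard hsub
    have hnot : i ∉ {j | discMass lam (y j) ≤ a} := fun h => absurd hi (not_lt.2 h)
    rw [encard_insert_of_notMem hnot, encard_setOf_le_pnat] at h2
    have h3 : ((i : ℕ) : ℕ∞) + 1 ≤ ((i : ℕ) : ℕ∞) := (add_le_add_left h 1).trans h2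
    have h4 : ((i : ℕ) + 1) ≤ (i : ℕ) := ENat.natCast_le_natCast.1 h3
    omega
  · intro h
    rw [← encard_setOf_le_pnat]
    exact encard_le_encard fun j hj => (hle hj).trans h

theorem IsNearestEnumeration.ae_le_count_iff (hx : IsNearestEnumeration μ Φ x) (hlam : 0 < lam) :
    ∀ᵐ ω ∂μ, ∀ (i : ℕ+) (a : ℝ), ((i : ℕ) : ℕ∞) ≤ pointCount Φ (massDisc lam a) ω ↔
      discMass lam (x i ω) ≤ a := by
  filter_upwards [hx.strictMono, hx.range_eq] with ω hmono hrange i a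
  exact le_encard_massDisc_iff hlam hmono hrange i a

/-- One null set serves all a and b, so the equivalence may be applied to annuli with random
endpoints. -/
theorem IsNearestEnumeration.ae_count_massAnnulus_eq_zero_iff (hx : IsNearestEnumeration μ Φ x) :
    ∀ᵐ ω ∂μ, ∀ a b : ℝ, pointCount Φ (massAnnulus lam a b) ω = 0 ↔
      ∀ i, a < discMass lam (x i ω) → b < discMass lam (x i ω) := by
  filter_upwards [hx.range_eq] with ω hrange a b
  rw [pointCount, encard_eq_zero, ← hrange, ← disjoint_iff_inter_eq_empty, Set.disjoint_left]
  simp [massAnnulus]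

theorem IsNearestEnumeration.ae_strictMono_discMass (hx : IsNearestEnumeration μ Φ x)
    (hlam : 0 < lam) : ∀ᵐ ω ∂μ, StrictMono fun i => discMass lam (x i ω) := by
  filter_upwards [hx.strictMono] with ω hmono i j hij
  exact (discMass_lt_iff hlam).2 (hmono hij)

theorem IsNearestEnumeration.measurable_discMass (hx : IsNearestEnumeration μ Φ x) (i : ℕ+) :
    Measurable fun ω => discMass lam (x i ω) :=
  _root_.measurable_discMass.comp (hx.measurable i)

theorem IsNearestEnumeration.measurableSet_past (hx : IsNearestEnumeration μ Φ x) (K : ℕ+)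
    (t : Iic K → ℝ) : MeasurableSet {ω | ∀ i : Iic K, discMass lam (x i ω) ≤ t i} := by
  rw [ofPred_forall]
  exact MeasurableSet.iInter fun i =>
    measurableSet_le (hx.measurable_discMass _) measurable_const

/-- The origin has area zero, so its count is Poisson with mean 0. This keeps negative powers of the
distances away from their conventional value at 0. -/
theorem IsNearestEnumeration.ae_norm_pos (hx : IsNearestEnumeration μ Φ x)
    (hΦ : IsHomogeneousPPP μ lam Φ) (hlam : 0 ≤ lam) [IsProbabilityMeasure μ] :
    ∀ᵐ ω ∂μ, ∀ i, 0 < ‖x i ω‖ := by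
  have hv : volume ({0} : Set Plane) = 0 := measure_singleton _
  have h1 : μ {ω | pointCount Φ {0} ω = 0} = 1 := by
    rw [hΦ.measure_count_eq_zero (measurableSet_singleton _) (by simp [hv]) hlam, hv]
    simp
  have h0 : ∀ᵐ ω ∂μ, pointCount Φ {0} ω = 0 := by
    have hset : MeasurableSet {ω | pointCount Φ {0} ω = 0} :=
      hΦ.measurable_count _ (measurableSet_singleton _) (measurableSet_singleton 0)
    rw [← prob_compl_eq_zero_iff hset] at h1
    exact h1
  filter_upwards [h0, hx.range_eq] with ω h hrange i
  rw [norm_pos_iff]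
  intro hi
  rw [pointCount, encard_eq_zero, ← hrange] at h
  exact h.le ⟨⟨i, hi⟩, rfl⟩

/-- Bounded distances would put infinitely many distinct points in one disc, whose count is almost
surely finite. -/
theorem IsNearestEnumeration.ae_tendsto_norm_atTop (hx : IsNearestEnumeration μ Φ x)
    (hΦ : IsHomogeneousPPP μ lam Φ) : ∀ᵐ ω ∂μ, Tendsto (fun i => ‖x i ω‖) atTop atTop := by
  have hfin : ∀ᵐ ω ∂μ, ∀ n : ℕ, pointCount Φ (Metric.closedBall 0 n) ω ≠ ⊤ :=
    ae_all_iff.2 fun n => hΦ.ae_count_ne_top Metric.isClosed_closedBall.measurableSet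
      measure_closedBall_lt_top
  filter_upwards [hfin, hx.strictMono, hx.range_eq] with ω hω hmono hrange
  refine tendsto_atTop_atTop_of_monotone hmono.monotone fun b => ?_
  by_contra! hb
  obtain ⟨n, hn⟩ := exists_nat_ge b
  refine hω n ?_
  rw [pointCount, encard_eq_top_iff, ← hrange]
  have hsub : range (fun i => x i ω) ⊆ Metric.closedBall 0 n := by
    rintro _ ⟨i, rfl⟩
    simpa using (hb i).le.trans hn
  rw [inter_eq_left.2 hsub]
  exact infinite_range_of_injective fun j k h => hmono.injective (congrArg norm h)

/-- Points lying within a disc are independent of the absence of points in an annulus outside. -/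
theorem measure_past_inter_void [IsProbabilityMeasure μ] (hlam : 0 < lam)
    (hΦ : IsHomogeneousPPP μ lam Φ) (hx : IsNearestEnumeration μ Φ x) (K : ℕ+) (t : Iic K → ℝ)
    {b c : ℝ} (hb : 0 ≤ b) (hc : 0 ≤ c) (ht : ∀ i, t i ≤ b) :
    μ ({ω | ∀ i : Iic K, discMass lam (x i ω) ≤ t i} ∩
        {ω | pointCount Φ (massAnnulus lam b (b + c)) ω = 0}) =
      μ {ω | ∀ i : Iic K, discMass lam (x i ω) ≤ t i} * ENNReal.ofReal (Real.exp (-c)) := by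
  have hvol := volume_massAnnulus hlam hb (le_add_of_nonneg_right hc)
  have hvoid : μ {ω | pointCount Φ (massAnnulus lam b (b + c)) ω = 0} =
      ENNReal.ofReal (Real.exp (-c)) := by
    rw [hΦ.measure_count_eq_zero measurableSet_massAnnulus (by simp [hvol]) hlam.le, hvol,
      ENNReal.toReal_ofReal (div_nonneg (by linarith) hlam.le)]
    congr 3
    field_simp
    ring
  have hind := hΦ.indepFun_count (A := fun i : Iic K => massDisc lam (t i))
    (B := massAnnulus lam b (b + c)) (fun i => measurableSet_massDisc) measurableSet_massAnnulus
    (fun i => Set.disjoint_left.2 fun z hz hz' => absurd hz'.1 (not_lt.2 (le_trans hz (ht i))))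
  have hset : MeasurableSet {v : Iic K → ℕ∞ | ∀ i : Iic K, (((i : ℕ+) : ℕ) : ℕ∞) ≤ v i} :=
    by
    rw [ofPred_forall]
    exact MeasurableSet.iInter fun i => measurable_pi_apply i (MeasurableSet.of_discrete (s := Ici _))
  have hprod := hind.measure_inter_preimage_eq_mul _ _ hset (measurableSet_singleton 0)
  -- The event on positions is an event on counts in discs of mass at most b, all disjoint from the
  -- annulus.
  have hae : {ω | ∀ i : Iic K, discMass lam (x i ω) ≤ t i} =ᵐ[μ]
      (fun ω (i : Iic K) => pointCount Φ (massDisc lam (t i)) ω) ⁻¹'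
        {v | ∀ i : Iic K, (((i : ℕ+) : ℕ) : ℕ∞) ≤ v i} := by
    filter_upwards [hx.ae_le_count_iff hlam] with ω hω
    exact propext (forall_congr' fun i => (hω i (t i)).symm)
  rw [measure_congr hae, ← hvoid]
  exact (measure_congr (hae.inter (ae_eq_refl _))).trans hprod

end OrderedPoints

/-! ### The gap after the K-th point is exponential and independent of the past. -/

section Gap

variable {Ω : Type*} [MeasurableSpace Ω] {μ : Measure Ω} [IsProbabilityMeasure μ] {lam : ℝ}
  {Φ : Ω → Set Plane} {x : ℕ+ → Ω → Plane}

/-- `measure_past_inter_void` on the event that the `K`-th nearest point lies between two circles. -/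
theorem measure_past_inter_cell_inter_void (hlam : 0 < lam)
    (hΦ : IsHomogeneousPPP μ lam Φ) (hx : IsNearestEnumeration μ Φ x) (K : ℕ+) (t : Iic K → ℝ)
    {a b c : ℝ} (hb : 0 ≤ b) (hc : 0 ≤ c) (hab : a ≤ b) :
    μ ({ω | (∀ i : Iic K, discMass lam (x i ω) ≤ t i) ∧
          a < discMass lam (x K ω) ∧ discMass lam (x K ω) ≤ b} ∩
        {ω | pointCount Φ (massAnnulus lam b (b + c)) ω = 0}) =
      μ {ω | (∀ i : Iic K, discMass lam (x i ω) ≤ t i) ∧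
          a < discMass lam (x K ω) ∧ discMass lam (x K ω) ≤ b} *
        ENNReal.ofReal (Real.exp (-c)) := by
  set Z := {ω | pointCount Φ (massAnnulus lam b (b + c)) ω = 0} with hZ
  -- By monotonicity the K-th point is within mass u iff all of the first K are, so the cell event
  -- is D b \ D a and the claim follows by subtraction.
  let D (u : ℝ) : Set Ω := {ω | ∀ i : Iic K, discMass lam (x i ω) ≤ min (t i) u}
  have hDm : ∀ u, MeasurableSet (D u) := fun u => hx.measurableSet_past K _
  have hZm : MeasurableSet Z :=
    hΦ.measurable_count _ measurableSet_massAnnulus (measurableSet_singleton 0)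
  have hsub : D a ⊆ D b := fun ω h i => (h i).trans (min_le_min_left _ hab)
  have hae : {ω | (∀ i : Iic K, discMass lam (x i ω) ≤ t i) ∧
      a < discMass lam (x K ω) ∧ discMass lam (x K ω) ≤ b} =ᵐ[μ] (D b \ D a : Set Ω) := by
    filter_upwards [hx.ae_strictMono_discMass hlam] with ω hmono
    have hle : ∀ i : Iic K, discMass lam (x i ω) ≤ discMass lam (x K ω) :=
      fun i => hmono.monotone i.2
    refine propext ⟨fun ⟨h1, h2, h3⟩ => ⟨fun i => le_min (h1 i) ((hle i).trans h3), fun h => ?_⟩,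
      fun ⟨h1, h2⟩ => ?_⟩
    · exact absurd ((h ⟨K, le_refl K⟩).trans (min_le_right _ _)) (not_le.2 h2)
    · have h3 : ∀ i : Iic K, discMass lam (x i ω) ≤ t i := fun i => (h1 i).trans (min_le_left _ _)
      refine ⟨h3, ?_, (h1 ⟨K, le_refl K⟩).trans (min_le_right _ _)⟩
      by_contra! h4
      exact h2 fun i => le_min (h3 i) ((hle i).trans h4)
  have hDZ : ∀ u ≤ b, μ (D u ∩ Z) = μ (D u) * ENNReal.ofReal (Real.exp (-c)) := fun u hu =>
    measure_past_inter_void hlam hΦ hx K _ hb hc fun i => (min_le_right _ _).trans hu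
  rw [measure_congr hae]
  refine (measure_congr (hae.inter (ae_eq_refl Z))).trans ?_
  rw [inter_sdiff_distrib_right, measure_sdiff (inter_subset_inter_left _ hsub)
      ((hDm a).inter hZm).nullMeasurableSet (measure_ne_top _ _), hDZ _ hab, hDZ _ le_rfl,
    measure_sdiff hsub (hDm a).nullMeasurableSet (measure_ne_top _ _),
    ENNReal.sub_mul fun _ _ => ENNReal.ofReal_ne_top]

/-- The case j = 0 is included: its lower bound is -1, which nonnegativity of y makes vacuous. -/
theorem natCeil_eq_iff_of_nonneg {y : ℝ} (hy : 0 ≤ y) (j : ℕ) :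
    ⌈y⌉₊ = j ↔ (j : ℝ) - 1 < y ∧ y ≤ j := by
  rcases Nat.eq_zero_or_pos j with rfl | hj
  · rw [Nat.ceil_eq_zero]
    exact ⟨fun h => ⟨by push_cast; linarith, by simpa using h⟩, fun h => by simpa using h.2⟩
  · rw [Nat.ceil_eq_iff hj.ne', Nat.cast_pred hj]

/-- The annulus of given mass that starts at the position of the `K`-th nearest point rounded up to
a multiple of `1 / m` is void independently of the positions of the `K` nearest points. -/
theorem measure_past_inter_void_ceil (hlam : 0 < lam)
    (hΦ : IsHomogeneousPPP μ lam Φ) (hx : IsNearestEnumeration μ Φ x) (K : ℕ+) (t : Iic K → ℝ)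
    {m c : ℝ} (hm : 0 < m) (hc : 0 ≤ c) :
    MeasurableSet {ω | (∀ i : Iic K, discMass lam (x i ω) ≤ t i) ∧
        pointCount Φ (massAnnulus lam (⌈discMass lam (x K ω) * m⌉₊ / m)
          (⌈discMass lam (x K ω) * m⌉₊ / m + c)) ω = 0} ∧
    μ {ω | (∀ i : Iic K, discMass lam (x i ω) ≤ t i) ∧
        pointCount Φ (massAnnulus lam (⌈discMass lam (x K ω) * m⌉₊ / m)
          (⌈discMass lam (x K ω) * m⌉₊ / m + c)) ω = 0} =
      μ {ω | ∀ i : Iic K, discMass lam (x i ω) ≤ t i} * ENNReal.ofReal (Real.exp (-c)) := by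
  -- The rounded position takes countably many values; on C j it equals j / m, so the annulus there
  -- is deterministic.
  let C (j : ℕ) : Set Ω := {ω | (∀ i : Iic K, discMass lam (x i ω) ≤ t i) ∧
    ((j : ℝ) - 1) / m < discMass lam (x K ω) ∧ discMass lam (x K ω) ≤ j / m}
  let Z (j : ℕ) : Set Ω := {ω | pointCount Φ (massAnnulus lam (j / m) (j / m + c)) ω = 0}
  have hmem : ∀ j ω, ω ∈ C j ↔ (∀ i : Iic K, discMass lam (x i ω) ≤ t i) ∧
      ⌈discMass lam (x K ω) * m⌉₊ = j := fun j ω => by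
    rw [natCeil_eq_iff_of_nonneg (mul_nonneg (discMass_nonneg hlam.le _) hm.le),
      ← div_lt_iff₀ hm, ← le_div_iff₀ hm]
    rfl
  have hCm : ∀ j, MeasurableSet (C j) := fun j => by
    exact MeasurableSet.inter (hx.measurableSet_past K t) (MeasurableSet.inter
      (measurableSet_lt measurable_const (hx.measurable_discMass _))
      (measurableSet_le (hx.measurable_discMass _) measurable_const))
  have hZm : ∀ j, MeasurableSet (Z j) := fun j =>
    hΦ.measurable_count _ measurableSet_massAnnulus (measurableSet_singleton 0)
  have hdisj : Pairwise (Function.onFun Disjoint C) := fun j k hjk =>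
    Set.disjoint_left.2 fun ω h h' => hjk (((hmem j ω).1 h).2.symm.trans ((hmem k ω).1 h').2)
  have hE : {ω | ∀ i : Iic K, discMass lam (x i ω) ≤ t i} = ⋃ j, C j := by
    ext ω
    simp [hmem]
  have hEZ : {ω | (∀ i : Iic K, discMass lam (x i ω) ≤ t i) ∧
      pointCount Φ (massAnnulus lam (⌈discMass lam (x K ω) * m⌉₊ / m)
        (⌈discMass lam (x K ω) * m⌉₊ / m + c)) ω = 0} = ⋃ j, C j ∩ Z j := by
    ext ω
    simp only [mem_iUnion, mem_inter_iff, hmem]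
    constructor
    · exact fun h => ⟨_, ⟨h.1, rfl⟩, h.2⟩
    · rintro ⟨j, ⟨h1, rfl⟩, h2⟩
      exact ⟨h1, h2⟩
  rw [hEZ]
  refine ⟨MeasurableSet.iUnion fun j => (hCm j).inter (hZm j), ?_⟩
  rw [hE, measure_iUnion hdisj hCm, measure_iUnion
    (fun j k hjk => (hdisj hjk).mono inter_subset_left inter_subset_left)
    fun j => (hCm j).inter (hZm j), ← ENNReal.tsum_mul_right]
  refine tsum_congr fun j => ?_
  exact measure_past_inter_cell_inter_void hlam hΦ hx K t (by positivity) hc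
    (div_le_div_of_nonneg_right (by linarith) hm.le)

/-- The memoryless property of the ordered points on orthants. -/
theorem measure_past_inter_gap (hlam : 0 < lam)
    (hΦ : IsHomogeneousPPP μ lam Φ) (hx : IsNearestEnumeration μ Φ x) (K : ℕ+) (t : Iic K → ℝ)
    {c : ℝ} (hc : 0 ≤ c) :
    μ {ω | (∀ i : Iic K, discMass lam (x i ω) ≤ t i) ∧
        c < discMass lam (x (K + 1) ω) - discMass lam (x K ω)} =
      μ {ω | ∀ i : Iic K, discMass lam (x i ω) ≤ t i} * ENNReal.ofReal (Real.exp (-c)) := by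
  have hpos : ∀ n : ℕ, (0 : ℝ) < n + 1 := fun n => by positivity
  -- The mesh 1 / m is refined with m = n + 1; every approximating event has the same probability,
  -- so only convergence of indicators remains.
  have hlim := tendsto_measure_of_ae_tendsto_indicator_of_isFiniteMeasure (μ := μ) atTop
    (A := {ω | (∀ i : Iic K, discMass lam (x i ω) ≤ t i) ∧
        c < discMass lam (x (K + 1) ω) - discMass lam (x K ω)}) ?_
    (fun n : ℕ => (measure_past_inter_void_ceil hlam hΦ hx K t (hpos n) hc).1) ?_
  · simp_rw [(measure_past_inter_void_ceil hlam hΦ hx K t (hpos _) hc).2] at hlim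
    exact tendsto_nhds_unique hlim tendsto_const_nhds
  · exact MeasurableSet.inter (hx.measurableSet_past K t) (measurableSet_lt measurable_const
      ((hx.measurable_discMass _).sub (hx.measurable_discMass _)))
  · filter_upwards [hx.ae_strictMono_discMass hlam,
      hx.ae_count_massAnnulus_eq_zero_iff (lam := lam)] with ω hmono hcount
    set u := discMass lam (x K ω) with hu
    set v := discMass lam (x (K + 1) ω) with hv
    have hu0 : 0 ≤ u := discMass_nonneg hlam.le _
    have hKlt : K < K + 1 := PNat.lt_add_right K 1
    have huv : u < v := hmono hKlt
    have hcv : Tendsto (fun n : ℕ => (⌈u * ((n : ℝ) + 1)⌉₊ : ℝ) / ((n : ℝ) + 1)) atTop (𝓝 u) := by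
      have h := (tendsto_nat_ceil_mul_div_atTop hu0).comp
        (tendsto_natCast_atTop_atTop.comp (tendsto_add_atTop_nat 1))
      simpa [Function.comp_def] using h
    have hge : ∀ n : ℕ, u ≤ (⌈u * ((n : ℝ) + 1)⌉₊ : ℝ) / ((n : ℝ) + 1) := fun n => by
      rw [le_div_iff₀ (hpos n)]
      exact Nat.le_ceil _
    by_cases hgap : c < v - u
    -- Eventually the rounded annulus ends before v, and any point beyond its start has index above
    -- K, hence mass at least v.
    · have hlt : u < v - c := by linarith
      filter_upwards [hcv.eventually_lt_const hlt] with n hn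
      refine and_congr_right fun _ => ?_
      simp only [hgap, iff_true, hcount]
      intro i hi
      have hKi : K < i := by
        by_contra! h
        exact absurd (hmono.monotone h) (not_le.2 ((hge n).trans_lt hi))
      have : v ≤ discMass lam (x i ω) := hmono.monotone (PNat.add_one_le_iff.2 hKi)
      linarith
    -- Eventually the annulus starts before v, and rounding up makes it end at u + c ≥ v or later,
    -- so it contains the next point, also when v - u = c.
    · filter_upwards [hcv.eventually_lt_const huv] with n hn
      refine and_congr_right fun _ => ?_
      simp only [hgap, iff_false, hcount]
      intro h
      have h1 := h (K + 1) hn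
      have h2 := hge n
      rw [← hv] at h1
      linarith

/-- The mass of the annulus between consecutive nearest points is exponentially distributed and
independent of the nearer points. -/
theorem map_past_gap_eq_prod (hlam : 0 < lam)
    (hΦ : IsHomogeneousPPP μ lam Φ) (hx : IsNearestEnumeration μ Φ x) (K : ℕ+) :
    μ.map (fun ω => ((fun i : Iic K => discMass lam (x i ω)),
        discMass lam (x (K + 1) ω) - discMass lam (x K ω))) =
      (μ.map fun ω (i : Iic K) => discMass lam (x i ω)).prod (expMeasure 1) := by
  set past : Ω → Iic K → ℝ := fun ω i => discMass lam (x i ω) with hpast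
  set gap : Ω → ℝ := fun ω => discMass lam (x (K + 1) ω) - discMass lam (x K ω) with hgap
  have hpm : Measurable past := measurable_pi_lambda _ fun i => hx.measurable_discMass _
  have hgm : Measurable gap := (hx.measurable_discMass _).sub (hx.measurable_discMass _)
  -- Two π-system extensions: first from orthants to all past events with the ray of the gap fixed,
  -- then from rays to all gap events with the past event fixed.
  have horth : ∀ c : ℝ, 0 ≤ c → (μ.restrict (gap ⁻¹' Ioi c)).map past =
      ENNReal.ofReal (Real.exp (-c)) • μ.map past := by
    intro c hc
    have hgen : (MeasurableSpace.pi : MeasurableSpace (Iic K → ℝ)) =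
        MeasurableSpace.generateFrom (univ.pi '' univ.pi fun _ : Iic K => range (Iic : ℝ → Set ℝ)) := by
      rw [← generateFrom_pi_eq]
      · congr 1
        ext i
        rw [← borel_eq_generateFrom_Iic, ← BorelSpace.measurable_eq]
      · intro i
        refine ⟨fun n => Iic (n : ℝ), fun n => ⟨n, rfl⟩, ?_⟩
        exact eq_univ_of_forall fun y => mem_iUnion.2 (exists_nat_ge y)
    have hrestr := Measure.isFiniteMeasure_map (μ.restrict (gap ⁻¹' Ioi c)) past
    refine Measure.ext_of_generateFrom_of_iUnion _ (fun n : ℕ => univ.pi fun _ => Iic (n : ℝ))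
      hgen (IsPiSystem.pi fun _ => isPiSystem_Iic) ?_
      (fun n => ⟨_, fun i _ => ⟨n, rfl⟩, rfl⟩) (fun n => measure_ne_top _ _) ?_
    · refine eq_univ_of_forall fun v => mem_iUnion.2 ?_
      obtain ⟨M, hM⟩ := (finite_range v).bddAbove
      obtain ⟨n, hn⟩ := exists_nat_ge M
      exact ⟨n, fun i _ => (hM ⟨i, rfl⟩).trans hn⟩
    · rintro _ ⟨S, hS, rfl⟩
      choose t ht using fun i => hS i (mem_univ i)
      obtain rfl : (fun i => Iic (t i)) = S := funext ht
      have hSm : MeasurableSet (univ.pi fun i => Iic (t i)) :=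
        MeasurableSet.univ_pi fun i => measurableSet_Iic
      have hpre : past ⁻¹' (univ.pi fun i => Iic (t i)) =
          {ω | ∀ i : Iic K, discMass lam (x i ω) ≤ t i} := by
        ext ω
        simp only [hpast, mem_preimage, mem_univ_pi, mem_Iic, mem_ofPred_eq]
      rw [Measure.map_apply hpm hSm, Measure.restrict_apply (hpm hSm), Measure.smul_apply,
        Measure.map_apply hpm hSm, smul_eq_mul, mul_comm, hpre]
      exact measure_past_inter_gap hlam hΦ hx K t hc
  have hpast_gap : ∀ A, MeasurableSet A → ∀ c : ℝ, 0 ≤ c →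
      μ (past ⁻¹' A ∩ gap ⁻¹' Ioi c) = μ (past ⁻¹' A) * expMeasure 1 (Ioi c) := by
    intro A hA c hc
    have h := congrArg (fun ν => ν A) (horth c hc)
    simp only [Measure.map_apply hpm hA, Measure.restrict_apply (hpm hA), Measure.smul_apply,
      smul_eq_mul] at h
    rw [h, expMeasure_one_Ioi hc, mul_comm]
  have hgap_pos : ∀ᵐ ω ∂μ, 0 < gap ω := by
    filter_upwards [hx.ae_strictMono_discMass hlam] with ω hmono
    exact sub_pos.2 (hmono (PNat.lt_add_right K 1))
  have hexp_pos : ∀ᵐ u ∂(expMeasure 1), 0 < u := by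
    have h := expMeasure_one_Ioi le_rfl
    rw [neg_zero, Real.exp_zero, ENNReal.ofReal_one, ← prob_compl_eq_zero_iff measurableSet_Ioi] at h
    exact h
  have hA : ∀ A, MeasurableSet A →
      (μ.restrict (past ⁻¹' A)).map gap = μ (past ⁻¹' A) • expMeasure 1 := by
    intro A hA
    have hrestr := Measure.isFiniteMeasure_map (μ.restrict (past ⁻¹' A)) gap
    refine Measure.ext_of_generateFrom_of_iUnion (range Ioi) (fun n : ℕ => Ioi (-(n : ℝ)))
      ((BorelSpace.measurable_eq (α := ℝ)).trans (borel_eq_generateFrom_Ioi ℝ)) isPiSystem_Ioi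
      ?_ (fun n => ⟨_, rfl⟩) (fun n => measure_ne_top _ _) ?_
    · refine eq_univ_of_forall fun y => mem_iUnion.2 ?_
      obtain ⟨n, hn⟩ := exists_nat_gt (-y)
      exact ⟨n, by simp only [mem_Ioi]; linarith⟩
    · rintro _ ⟨c, rfl⟩
      rw [Measure.map_apply hgm measurableSet_Ioi, Measure.restrict_apply (hgm measurableSet_Ioi),
        Measure.smul_apply, smul_eq_mul, inter_comm]
      rcases le_total 0 c with hc | hc
      · exact hpast_gap A hA c hc
      -- The generating rays include c ≤ 0, where the condition is almost surely void for the gap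
      -- and for the exponential law alike.
      · have h1 : (past ⁻¹' A ∩ gap ⁻¹' Ioi c : Set Ω) =ᵐ[μ] past ⁻¹' A := by
          filter_upwards [hgap_pos] with ω hω
          exact propext (and_iff_left (hc.trans_lt hω))
        have h2 : expMeasure 1 (Ioi c) = 1 := by
          rw [← prob_compl_eq_zero_iff measurableSet_Ioi]
          exact measure_mono_null (compl_subset_compl.2 (Ioi_subset_Ioi hc)) hexp_pos
        rw [measure_congr h1, h2, mul_one]
  have hmap := Measure.isFiniteMeasure_map μ fun ω => (past ω, gap ω)
  refine Measure.ext_prod fun {A B} hAm hBm => ?_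
  rw [Measure.map_apply (hpm.prodMk hgm) (hAm.prod hBm), Measure.prod_prod,
    Measure.map_apply hpm hAm]
  have h := congrArg (fun ν => ν B) (hA A hAm)
  simp only [Measure.map_apply hgm hBm, Measure.restrict_apply (hgm hBm), Measure.smul_apply,
    smul_eq_mul] at h
  rw [← h, inter_comm]
  rfl

end Gap

/-! ### Dominant factors and partial sums of the interference. -/

section Geometry

variable {Ω : Type*} {x : ℕ+ → Ω → Plane}

/-- The Laplace transform at `s`, given the geometry, of the noise and of the interference of the
base stations `2, …, n`. -/
noncomputable def dominantFactor (x : ℕ+ → Ω → Plane) (η σ T : ℝ) (n : ℕ+) (ω : Ω) : ℝ :=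
  Real.exp (-(sVar x η T ω * σ ^ 2)) *
    ∏ i ∈ Finset.Icc 2 n, 1 / (1 + sVar x η T ω * bsDist x i ω ^ (-η))

theorem sVar_nonneg {η T : ℝ} (hT : 0 ≤ T) (ω : Ω) : 0 ≤ sVar x η T ω :=
  mul_nonneg hT (Real.rpow_nonneg (norm_nonneg _) _)

theorem dominantFactor_nonneg {η σ T : ℝ} (hT : 0 ≤ T) (n : ℕ+) (ω : Ω) :
    0 ≤ dominantFactor x η σ T n ω := by
  refine mul_nonneg (Real.exp_pos _).le (Finset.prod_nonneg fun i _ => ?_)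
  have := mul_nonneg (sVar_nonneg (x := x) (η := η) hT ω)
    (Real.rpow_nonneg (norm_nonneg (x i ω)) (-η))
  exact one_div_nonneg.2 (add_nonneg zero_le_one this)

theorem dominantFactor_le_one {η σ T : ℝ} (hT : 0 ≤ T) (n : ℕ+) (ω : Ω) :
    dominantFactor x η σ T n ω ≤ 1 := by
  have hs := sVar_nonneg (x := x) (η := η) hT ω
  have hterm : ∀ i, 0 ≤ sVar x η T ω * bsDist x i ω ^ (-η) := fun i =>
    mul_nonneg hs (Real.rpow_nonneg (norm_nonneg (x i ω)) (-η))
  refine mul_le_one₀ ?_ (Finset.prod_nonneg fun i _ => ?_) (Finset.prod_le_one (fun i _ => ?_)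
    fun i _ => ?_)
  · rw [Real.exp_le_one_iff, neg_nonpos]
    positivity
  · exact one_div_nonneg.2 (add_nonneg zero_le_one (hterm i))
  · exact one_div_nonneg.2 (add_nonneg zero_le_one (hterm i))
  · exact div_le_one_of_le₀ (by linarith [hterm i]) (by linarith [hterm i])

theorem pnat_filter_ne_one_Icc (n : ℕ+) : (Finset.Icc 1 n).filter (· ≠ 1) = Finset.Icc 2 n := by
  ext i
  simp only [Finset.mem_filter, Finset.mem_Icc, ← PNat.coe_le_coe, ne_eq, ← PNat.coe_inj]
  have := i.pos
  simp only [PNat.val_ofNat]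
  omega

/-- Sums in `ℝ≥0∞` converge unconditionally, so exhausting the indices by intervals suffices; the
limit may be ⊤. -/
theorem tendsto_interference (x : ℕ+ → Ω → Plane) (g : ℕ+ → Ω → ℝ) (η : ℝ) (ω : Ω) :
    Tendsto (fun n : ℕ+ => ∑ i ∈ Finset.Icc 2 n, ENNReal.ofReal (g i ω * bsDist x i ω ^ (-η)))
      atTop (𝓝 (interference x g η ω)) := by
  classical
  set f : ℕ+ → ℝ≥0∞ := fun i => ENNReal.ofReal (g i ω * bsDist x i ω ^ (-η)) with hf
  have hI : interference x g η ω = ∑' i, {i : ℕ+ | i ≠ 1}.indicator f i := tsum_subtype _ f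
  have hto : Tendsto (fun n : ℕ+ => Finset.Icc 1 n) atTop atTop :=
    tendsto_atTop_finset_of_monotone (fun m n h => Finset.Icc_subset_Icc_right h)
      fun i => ⟨i, by simp⟩
  rw [hI]
  refine (ENNReal.summable.hasSum.comp hto).congr fun n => ?_
  rw [← pnat_filter_ne_one_Icc, Finset.sum_filter]
  exact Finset.sum_congr rfl fun i _ => by simp [indicator_apply, hf]

end Geometry

/-! ### Averaging out the fading gains. -/

section Fading

variable {Ω : Type*} [MeasurableSpace Ω] {μ : Measure Ω}

/-- This plays the role of conditioning on Y, both when a single gain is averaged out and when the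
next gap is. -/
theorem lintegral_eq_of_map_eq_prod {β γ : Type*} [MeasurableSpace β] [MeasurableSpace γ]
    {Y : Ω → β} {Z : Ω → γ} {ν : Measure γ} [SFinite ν] (hY : Measurable Y) (hZ : Measurable Z)
    (h : μ.map (fun ω => (Y ω, Z ω)) = (μ.map Y).prod ν) {φ : β × γ → ℝ≥0∞} (hφ : Measurable φ) :
    ∫⁻ ω, φ (Y ω, Z ω) ∂μ = ∫⁻ ω, ∫⁻ z, φ (Y ω, z) ∂ν ∂μ := by
  rw [← lintegral_map hφ (hY.prodMk hZ), h, lintegral_prod _ hφ.aemeasurable,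
    lintegral_map (hφ.lintegral_prod_right') hY]

variable {x : ℕ+ → Ω → Plane} {g : ℕ+ → Ω → ℝ}

/-- Each gain is independent of the locations together with all the other gains. -/
theorem IsRayleighFading.map_others_gain_eq_prod [IsProbabilityMeasure μ]
    (hg : IsRayleighFading μ x g) (hx : ∀ i, Measurable (x i)) (n : ℕ+) :
    μ.map (fun ω => (((fun i => x i ω), fun i : {i // i ≠ n} => g i ω), g n ω)) =
      (μ.map fun ω => ((fun i => x i ω), fun i : {i // i ≠ n} => g i ω)).prod (expMeasure 1) := by
  set X : Ω → ℕ+ → Plane := fun ω i => x i ω with hX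
  set G : Ω → {i // i ≠ n} → ℝ := fun ω i => g i ω with hG
  have hXm : Measurable X := measurable_pi_lambda _ hx
  have hGm : Measurable G := measurable_pi_lambda _ fun i => hg.measurable i
  have hind : IndepFun G (g n) μ := by
    have h := indep_iSup_of_disjoint (fun i => (hg.measurable i).comap_le) hg.iIndep.iIndep
      (S := {i | i ≠ n}) (T := {n}) (by simp)
    rw [IndepFun_iff_Indep]
    refine indep_of_indep_of_le_left (indep_of_indep_of_le_right h ?_) ?_
    · simp
    · rw [MeasurableSpace.pi, MeasurableSpace.comap_iSup]
      refine iSup_le fun i => ?_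
      rw [MeasurableSpace.comap_comp]
      exact le_iSup₂_of_le (i : ℕ+) i.2 le_rfl
  -- X is independent of (G, g n), and G of g n, so the triple has a product law; reassociating it
  -- sets (X, G) against g n.
  have hpair : IndepFun X (fun ω => (G ω, g n ω)) μ :=
    hg.indep_locations.comp (φ := id)
      (ψ := fun v : ℕ+ → ℝ => ((fun i : {i // i ≠ n} => v i), v n)) measurable_id (by fun_prop)
  have hXG : IndepFun X G μ :=
    hg.indep_locations.comp (φ := id)
      (ψ := fun (v : ℕ+ → ℝ) (i : {i // i ≠ n}) => v i) measurable_id (by fun_prop)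
  have hgm := hg.measurable n
  rw [indepFun_iff_map_prod_eq_prod_map_map hGm.aemeasurable hgm.aemeasurable, hg.map_eq] at hind
  rw [indepFun_iff_map_prod_eq_prod_map_map hXm.aemeasurable (hGm.prodMk hgm).aemeasurable,
    hind] at hpair
  rw [indepFun_iff_map_prod_eq_prod_map_map hXm.aemeasurable hGm.aemeasurable] at hXG
  have := Measure.isFiniteMeasure_map μ X
  have := Measure.isFiniteMeasure_map μ G
  rw [hXG, ← (MeasurableEquiv.prodAssoc).map_measurableEquiv_injective.eq_iff,
    Measure.prodAssoc_prod, ← hpair, Measure.map_map (MeasurableEquiv.measurable _)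
      ((hXm.prodMk hGm).prodMk hgm)]
  rfl

theorem IsRayleighFading.ae_nonneg (hg : IsRayleighFading μ x g) : ∀ᵐ ω ∂μ, ∀ i, 0 ≤ g i ω := by
  refine ae_all_iff.2 fun i => ?_
  have h := ae_expMeasure_one_nonneg
  rw [← hg.map_eq i] at h
  exact ae_of_ae_map (hg.measurable i).aemeasurable h

/-- Averaging out finitely many gains with the geometry held fixed. -/
theorem IsRayleighFading.lintegral_mul_prod_exp [IsProbabilityMeasure μ]
    (hg : IsRayleighFading μ x g) (hx : ∀ i, Measurable (x i)) {c : ℕ+ → (ℕ+ → Plane) → ℝ}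
    (hc : ∀ i, Measurable (c i)) (hc0 : ∀ i ξ, 0 ≤ c i ξ) (S : Finset ℕ+)
    {h : (ℕ+ → Plane) → ℝ≥0∞} (hh : Measurable h) :
    ∫⁻ ω, h (fun i => x i ω) *
        ∏ i ∈ S, ENNReal.ofReal (Real.exp (-(c i (fun i => x i ω) * g i ω))) ∂μ =
      ∫⁻ ω, h (fun i => x i ω) *
        ∏ i ∈ S, ENNReal.ofReal (1 / (1 + c i (fun i => x i ω))) ∂μ := by
  classical
  -- The weight h is kept general because each averaged factor 1 / (1 + c n) is absorbed into it.
  induction S using Finset.induction_on generalizing h with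
  | empty => simp
  | insert n S hn ih =>
    -- The default 0 is never reached, since n is not in S.
    let φ : ((ℕ+ → Plane) × ({i // i ≠ n} → ℝ)) × ℝ → ℝ≥0∞ := fun p =>
      (h p.1.1 * ∏ i ∈ S, ENNReal.ofReal (Real.exp
        (-(c i p.1.1 * if hi : i ≠ n then p.1.2 ⟨i, hi⟩ else 0)))) *
        ENNReal.ofReal (Real.exp (-(c n p.1.1 * p.2)))
    have hφ : Measurable φ := by
      have h1 : ∀ i, Measurable fun p : ((ℕ+ → Plane) × ({i // i ≠ n} → ℝ)) × ℝ =>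
          if hi : i ≠ n then p.1.2 ⟨i, hi⟩ else 0 := by
        intro i
        by_cases hi : i ≠ n
        · simp only [hi, dif_pos, ne_eq, not_false_eq_true]
          fun_prop
        · simp only [hi, dif_neg, not_false_eq_true]
          fun_prop
      fun_prop
    have hne : ∀ i ∈ S, i ≠ n := fun i hi h => hn (h ▸ hi)
    have hcalc := lintegral_eq_of_map_eq_prod (μ := μ)
      (Y := fun ω => ((fun i => x i ω), fun i : {i // i ≠ n} => g i ω)) (Z := g n)
      (by have := hg.measurable; fun_prop) (hg.measurable n) (hg.map_others_gain_eq_prod hx n) hφ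
    have hinner : ∀ ω, ∫⁻ z, φ (((fun i => x i ω), fun i : {i // i ≠ n} => g i ω), z)
        ∂(expMeasure 1) = (h (fun i => x i ω) * ENNReal.ofReal (1 / (1 + c n (fun i => x i ω)))) *
          ∏ i ∈ S, ENNReal.ofReal (Real.exp (-(c i (fun i => x i ω) * g i ω))) := by
      intro ω
      simp only [φ]
      rw [lintegral_const_mul _ (by fun_prop), lintegral_exp_neg_mul_expMeasure_one (hc0 _ _),
        mul_right_comm]
      congr 1
      exact Finset.prod_congr rfl fun i hi => by rw [dif_pos (hne i hi)]
    have hleft : ∀ ω, h (fun i => x i ω) * ∏ i ∈ insert n S,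
        ENNReal.ofReal (Real.exp (-(c i (fun i => x i ω) * g i ω))) =
        φ (((fun i => x i ω), fun i : {i // i ≠ n} => g i ω), g n ω) := by
      intro ω
      simp only [φ]
      rw [Finset.prod_insert hn, mul_comm (ENNReal.ofReal _), ← mul_assoc]
      congr 2
      exact Finset.prod_congr rfl fun i hi => by rw [dif_pos (hne i hi)]
    simp_rw [hleft]
    rw [hcalc]
    simp_rw [hinner]
    have := hc n
    rw [ih (h := fun ξ => h ξ * ENNReal.ofReal (1 / (1 + c n ξ))) (by fun_prop)]
    simp_rw [Finset.prod_insert hn, mul_assoc]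

/-- The probability, given the total interference `I`, that the `SINR` of an `Exp(1)` gain exceeds
the threshold `s r^(-η)`. -/
noncomputable def coverageGiven (σ s : ℝ) (I : ℝ≥0∞) : ℝ≥0∞ :=
  if I = ⊤ then 0 else ENNReal.ofReal (Real.exp (-(s * (I.toReal + σ ^ 2))))

/-- For finite I the event is u > T r^η (I + σ²), with a denominator kept positive by the noise; for
I = ⊤ the ratio is 0 and the event is empty. -/
theorem expMeasure_one_sinr {σ T r η : ℝ} (hσ : 0 < σ) (hT : 0 < T) (hr : 0 < r) (I : ℝ≥0∞) :
    expMeasure 1 {u | ENNReal.ofReal T <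
        ENNReal.ofReal (u * r ^ (-η)) / (I + ENNReal.ofReal (σ ^ 2))} =
      coverageGiven σ (T * r ^ η) I := by
  have hrη := Real.rpow_pos_of_pos hr η
  rw [coverageGiven]
  split_ifs with hI
  · simp [hI]
  · have hD : 0 < I.toReal + σ ^ 2 := by positivity
    have hden : I + ENNReal.ofReal (σ ^ 2) = ENNReal.ofReal (I.toReal + σ ^ 2) := by
      rw [ENNReal.ofReal_add ENNReal.toReal_nonneg (by positivity), ENNReal.ofReal_toReal hI]
    rw [← expMeasure_one_Ioi (by positivity)]
    congr 1
    ext u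
    rw [mem_ofPred_eq, hden, ← ENNReal.ofReal_div_of_pos hD, ENNReal.ofReal_lt_ofReal_iff',
      Real.rpow_neg hr.le, mem_Ioi]
    have hiff : T < u * (r ^ η)⁻¹ / (I.toReal + σ ^ 2) ↔
        T * r ^ η * (I.toReal + σ ^ 2) < u := by
      rw [lt_div_iff₀ hD, ← div_eq_mul_inv, lt_div_iff₀ hrη, mul_right_comm]
    rw [← hiff]
    exact ⟨fun h => h.1, fun h => ⟨h, hT.trans h⟩⟩

/-- Since s > 0 the exponential vanishes as I grows, so continuity extends to ⊤ and finiteness of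
the interference never has to be shown. -/
theorem tendsto_coverageGiven {ι : Type*} {l : Filter ι} {v : ι → ℝ≥0∞} {I : ℝ≥0∞} {σ s : ℝ}
    (hs : 0 < s) (hv : ∀ n, v n ≠ ⊤) (h : Tendsto v l (𝓝 I)) :
    Tendsto (fun n => coverageGiven σ s (v n)) l (𝓝 (coverageGiven σ s I)) := by
  simp only [coverageGiven, hv, if_false]
  split_ifs with hI
  · subst hI
    have h1 : Tendsto (fun n => (v n).toReal) l atTop := by
      refine tendsto_atTop.2 fun b => ?_
      filter_upwards [ENNReal.tendsto_nhds_top_iff_nnreal.1 h b.toNNReal] with n hn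
      have h2 := ENNReal.toReal_mono (hv n) hn.le
      exact (Real.le_coe_toNNReal b).trans h2
    have h2 := Real.tendsto_exp_neg_atTop_nhds_zero.comp
      ((tendsto_atTop_add_const_right l (σ ^ 2) h1).const_mul_atTop hs)
    simpa using ENNReal.tendsto_ofReal h2
  · have h1 := (ENNReal.tendsto_toReal hI).comp h
    exact ENNReal.tendsto_ofReal
      ((Real.continuous_exp.tendsto _).comp ((h1.add_const _).const_mul s).neg)

theorem measurable_sVar (hx : ∀ i, Measurable (x i)) {η T : ℝ} : Measurable (sVar x η T) := by
  unfold sVar bsDist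
  fun_prop

theorem measurable_dominantFactor (hx : ∀ i, Measurable (x i)) {η σ T : ℝ} (n : ℕ+) :
    Measurable (dominantFactor x η σ T n) := by
  unfold dominantFactor sVar bsDist
  fun_prop

/-- The coverage probability as a limit over the number of interferers. -/
theorem tendsto_lintegral_dominantFactor [IsProbabilityMeasure μ] (hg : IsRayleighFading μ x g)
    (hx : ∀ i, Measurable (x i)) (hpos : ∀ᵐ ω ∂μ, 0 < ‖x 1 ω‖) {η σ T : ℝ} (hσ : 0 < σ)
    (hT : 0 < T) :
    Tendsto (fun n => ∫⁻ ω, ENNReal.ofReal (dominantFactor x η σ T n ω) ∂μ) atTop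
      (𝓝 (μ {ω | ENNReal.ofReal T < sinr x g η σ ω})) := by
  have hgm := hg.measurable
  have hprob : μ {ω | ENNReal.ofReal T < sinr x g η σ ω} =
      ∫⁻ ω, coverageGiven σ (sVar x η T ω) (interference x g η ω) ∂μ := by
    let A : Set (((ℕ+ → Plane) × ({i : ℕ+ // i ≠ 1} → ℝ)) × ℝ) :=
      {p | ENNReal.ofReal T < ENNReal.ofReal (p.2 * ‖p.1.1 1‖ ^ (-η)) /
        ((∑' i : {i : ℕ+ // i ≠ 1}, ENNReal.ofReal (p.1.2 i * ‖p.1.1 i‖ ^ (-η))) +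
          ENNReal.ofReal (σ ^ 2))}
    have hA : MeasurableSet A := by
      refine measurableSet_lt measurable_const (Measurable.div (by fun_prop)
        (Measurable.add (Measurable.tsum fun i => ?_) measurable_const))
      fun_prop
    have hcalc := lintegral_eq_of_map_eq_prod (μ := μ)
      (Y := fun ω => ((fun i => x i ω), fun i : {i : ℕ+ // i ≠ 1} => g i ω)) (Z := g 1)
      (by fun_prop) (hgm 1) (hg.map_others_gain_eq_prod hx 1)
      (φ := A.indicator fun _ => 1) (measurable_const.indicator hA)
    have hset : MeasurableSet {ω | ENNReal.ofReal T < sinr x g η σ ω} :=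
      (show Measurable fun ω => (((fun i => x i ω), fun i : {i : ℕ+ // i ≠ 1} => g i ω), g 1 ω)
        by fun_prop) hA
    rw [← lintegral_indicator_one hset]
    refine Eq.trans (lintegral_congr fun ω => rfl) (hcalc.trans (lintegral_congr_ae ?_))
    filter_upwards [hpos] with ω hω
    have h1 : ∀ u : ℝ, A.indicator (fun _ => (1 : ℝ≥0∞))
        (((fun i => x i ω), fun i : {i : ℕ+ // i ≠ 1} => g i ω), u) =
        {u | ENNReal.ofReal T < ENNReal.ofReal (u * ‖x 1 ω‖ ^ (-η)) /
          (interference x g η ω + ENNReal.ofReal (σ ^ 2))}.indicator 1 u := fun u => rfl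
    simp_rw [h1]
    rw [lintegral_indicator_one, expMeasure_one_sinr hσ hT hω]
    · rfl
    · exact measurableSet_lt measurable_const (by fun_prop)
  -- Almost surely q n is the coverage probability given the interference of stations 2, …, n. Its
  -- integral is that of the dominant factor, and the constant 1 dominates it as n grows.
  let q (n : ℕ+) (ω : Ω) : ℝ≥0∞ := ENNReal.ofReal (Real.exp (-(sVar x η T ω * σ ^ 2))) *
    ∏ i ∈ Finset.Icc 2 n,
      ENNReal.ofReal (Real.exp (-(sVar x η T ω * bsDist x i ω ^ (-η) * g i ω)))
  have hq : ∀ n, ∫⁻ ω, q n ω ∂μ = ∫⁻ ω, ENNReal.ofReal (dominantFactor x η σ T n ω) ∂μ := by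
    intro n
    have h := hg.lintegral_mul_prod_exp hx
      (c := fun i ξ => T * ‖ξ 1‖ ^ η * ‖ξ i‖ ^ (-η)) (fun i => by fun_prop)
      (fun i ξ => by positivity) (Finset.Icc 2 n)
      (h := fun ξ => ENNReal.ofReal (Real.exp (-(T * ‖ξ 1‖ ^ η * σ ^ 2)))) (by fun_prop)
    refine Eq.trans h (lintegral_congr fun ω => ?_)
    rw [dominantFactor, ENNReal.ofReal_mul (Real.exp_pos _).le, ENNReal.ofReal_prod_of_nonneg]
    · rfl
    · intro i _
      have := mul_nonneg (sVar_nonneg (x := x) (η := η) hT.le ω)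
        (Real.rpow_nonneg (norm_nonneg (x i ω)) (-η))
      exact one_div_nonneg.2 (add_nonneg zero_le_one this)
  simp_rw [← hq]
  rw [hprob]
  have hqeq : ∀ᵐ ω ∂μ, ∀ n, q n ω = coverageGiven σ (sVar x η T ω)
      (∑ i ∈ Finset.Icc 2 n, ENNReal.ofReal (g i ω * bsDist x i ω ^ (-η))) := by
    filter_upwards [hg.ae_nonneg] with ω hω n
    have hterm : ∀ i, 0 ≤ g i ω * bsDist x i ω ^ (-η) := fun i =>
      mul_nonneg (hω i) (Real.rpow_nonneg (norm_nonneg _) _)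
    rw [← ENNReal.ofReal_sum_of_nonneg fun i _ => hterm i, coverageGiven,
      if_neg ENNReal.ofReal_ne_top, ENNReal.toReal_ofReal (Finset.sum_nonneg fun i _ => hterm i)]
    simp only [q]
    rw [← ENNReal.ofReal_prod_of_nonneg fun i _ => (Real.exp_pos _).le, ← Real.exp_sum,
      ← ENNReal.ofReal_mul (Real.exp_pos _).le, ← Real.exp_add]
    congr 2
    rw [mul_add, Finset.mul_sum, Finset.sum_neg_distrib, neg_add, add_comm]
    congr 2
    exact Finset.sum_congr rfl fun i _ => by ring
  refine tendsto_lintegral_filter_of_dominated_convergence (fun _ => 1) ?_ ?_ (by simp) ?_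
  · refine Eventually.of_forall fun n => ?_
    have := measurable_sVar (x := x) hx (η := η) (T := T)
    simp only [q, bsDist]
    fun_prop
  · refine Eventually.of_forall fun n => ?_
    filter_upwards [hg.ae_nonneg] with ω hω
    have hs := sVar_nonneg (x := x) (η := η) hT.le ω
    refine mul_le_one' ?_ (Finset.prod_le_one' fun i _ => ?_)
    · rw [ENNReal.ofReal_le_one, Real.exp_le_one_iff, neg_nonpos]
      positivity
    · rw [ENNReal.ofReal_le_one, Real.exp_le_one_iff, neg_nonpos]
      exact mul_nonneg (mul_nonneg hs (Real.rpow_nonneg (norm_nonneg _) _)) (hω i)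
  · filter_upwards [hqeq, hpos] with ω hω hr
    simp_rw [hω]
    refine tendsto_coverageGiven (mul_pos hT (Real.rpow_pos_of_pos hr _)) (fun n => ?_)
      (tendsto_interference x g η ω)
    exact ENNReal.sum_ne_top.2 fun i _ => ENNReal.ofReal_ne_top

end Fading

/-! ### Invariance of the expected conditional coverage. -/

section Truncation

theorem pnat_Icc_two_add_one (K : ℕ+) :
    Finset.Icc 2 (K + 1) = insert (K + 1) (Finset.Icc 2 K) := by
  ext i
  simp only [Finset.mem_insert, Finset.mem_Icc, ← PNat.coe_le_coe, ← PNat.coe_inj, PNat.add_coe,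
    PNat.val_ofNat]
  have := K.pos
  omega

variable {Ω : Type*}

/-- The conditional expectation of the coverage indicator given the `n` nearest base stations:
the farther interferers enter through their Laplace functional. -/
noncomputable def conditionalCoverage (x : ℕ+ → Ω → Plane) (lam η σ T : ℝ) (n : ℕ+) (ω : Ω) : ℝ :=
  dominantFactor x η σ T n ω * Real.exp (-tailMass lam η (sVar x η T ω) (bsDist x n ω))

variable {lam η σ T : ℝ} {x : ℕ+ → Ω → Plane}

theorem exp_neg_tailMass_le_one (hlam : 0 ≤ lam) (hT : 0 ≤ T) (n : ℕ+) (ω : Ω) :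
    Real.exp (-tailMass lam η (sVar x η T ω) (bsDist x n ω)) ≤ 1 := by
  rw [Real.exp_le_one_iff, neg_nonpos]
  exact tailMass_nonneg hlam (sVar_nonneg hT ω) (norm_nonneg _)

theorem conditionalCoverage_nonneg (hT : 0 ≤ T) (n : ℕ+) (ω : Ω) :
    0 ≤ conditionalCoverage x lam η σ T n ω :=
  mul_nonneg (dominantFactor_nonneg hT n ω) (Real.exp_pos _).le

theorem conditionalCoverage_le_one (hlam : 0 ≤ lam) (hT : 0 ≤ T) (n : ℕ+) (ω : Ω) :
    conditionalCoverage x lam η σ T n ω ≤ 1 :=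
  mul_le_one₀ (dominantFactor_le_one hT n ω) (Real.exp_pos _).le
    (exp_neg_tailMass_le_one hlam hT n ω)

theorem hybridIntegrand_eq (hη : 2 < η) (hT : 0 < T) {K N : ℕ+} {ω : Ω}
    (hpos : ∀ i, 0 < ‖x i ω‖) :
    hybridIntegrand x lam η σ T K N ω = dominantFactor x η σ T K ω *
      Real.exp (-(tailMass lam η (sVar x η T ω) (bsDist x K ω) -
        tailMass lam η (sVar x η T ω) (bsDist x N ω))) := by
  have hs := sVar_nonneg (x := x) (η := η) hT.le ω
  rw [hybridIntegrand, dominantFactor, bsDist, bsDist,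
    tailMass_sub hη hs (hpos K) (hpos N)]
  congr 2
  refine Finset.prod_congr rfl fun i _ => ?_
  refine Eq.trans (integral_congr_ae (ae_of_all _ fun u => ?_)) (integral_exp_neg_mul_expMeasure_one
    (mul_nonneg hs (Real.rpow_nonneg (norm_nonneg (x i ω)) (-η))))
  simp only [bsDist]
  ring_nf

variable [MeasurableSpace Ω] {μ : Measure Ω}

theorem measurable_tailMass_comp (hx : ∀ i, Measurable (x i)) (n : ℕ+) :
    Measurable fun ω => tailMass lam η (sVar x η T ω) (bsDist x n ω) :=
  measurable_tailMass_uncurry.comp ((measurable_sVar hx).prodMk (hx n).norm)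

theorem measurable_conditionalCoverage (hx : ∀ i, Measurable (x i)) (n : ℕ+) :
    Measurable (conditionalCoverage x lam η σ T n) :=
  (measurable_dominantFactor hx n).mul (measurable_tailMass_comp hx n).neg.exp

variable [IsProbabilityMeasure μ] {Φ : Ω → Set Plane}

theorem integrable_conditionalCoverage (hlam : 0 ≤ lam) (hT : 0 ≤ T) (hx : ∀ i, Measurable (x i))
    (n : ℕ+) : Integrable (conditionalCoverage x lam η σ T n) μ := by
  refine Integrable.of_bound (measurable_conditionalCoverage hx n).aestronglyMeasurable 1
    (ae_of_all _ fun ω => ?_)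
  rw [Real.norm_of_nonneg (conditionalCoverage_nonneg hT n ω)]
  exact conditionalCoverage_le_one hlam hT n ω

theorem integrable_dominantFactor (hT : 0 ≤ T) (hx : ∀ i, Measurable (x i)) (n : ℕ+) :
    Integrable (dominantFactor x η σ T n) μ := by
  refine Integrable.of_bound (measurable_dominantFactor hx n).aestronglyMeasurable 1
    (ae_of_all _ fun ω => ?_)
  rw [Real.norm_of_nonneg (dominantFactor_nonneg hT n ω)]
  exact dominantFactor_le_one hT n ω

theorem sqrt_discMass_div (hlam : 0 < lam) (z : Plane) :
    √(discMass lam z / (lam * Real.pi)) = ‖z‖ := by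
  have hk : lam * Real.pi ≠ 0 := (mul_pos hlam Real.pi_pos).ne'
  rw [discMass, mul_div_cancel_left₀ _ hk, Real.sqrt_sq (norm_nonneg _)]

/-- Revealing one more base station does not change the expected conditional coverage. -/
theorem lintegral_conditionalCoverage_add_one (hlam : 0 < lam) (hη : 2 < η) (hT : 0 < T)
    (hΦ : IsHomogeneousPPP μ lam Φ) (hx : IsNearestEnumeration μ Φ x) (K : ℕ+) :
    ∫⁻ ω, ENNReal.ofReal (conditionalCoverage x lam η σ T (K + 1) ω) ∂μ =
      ∫⁻ ω, ENNReal.ofReal (conditionalCoverage x lam η σ T K ω) ∂μ := by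
  classical
  have hk : lam * Real.pi ≠ 0 := (mul_pos hlam Real.pi_pos).ne'
  let past : Ω → Iic K → ℝ := fun ω i => discMass lam (x i ω)
  -- Everything must be a function of the past masses for the product law to apply. The default 0
  -- for i > K is harmless: only indices from 1 to K are evaluated.
  let dist (v : Iic K → ℝ) (i : ℕ+) : ℝ :=
    √((if hi : i ≤ K then v ⟨i, hi⟩ else 0) / (lam * Real.pi))
  have hdist : ∀ i, Measurable fun v => dist v i := by
    intro i
    by_cases hi : i ≤ K
    · simp only [dist, hi, dif_pos]
      fun_prop
    · simp only [dist, hi, dif_neg, not_false_eq_true]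
      fun_prop
  have hdist_past : ∀ ω i, i ≤ K → dist (past ω) i = ‖x i ω‖ := fun ω i hi => by
    simp only [dist, dif_pos hi, past, sqrt_discMass_div hlam]
  let s (v : Iic K → ℝ) : ℝ := T * dist v 1 ^ η
  have hs : Measurable s := by
    have := hdist 1
    fun_prop
  have hs_past : ∀ ω, s (past ω) = sVar x η T ω := fun ω => by
    simp only [s, hdist_past ω 1 (one_le)]
    rfl
  let W (v : Iic K → ℝ) : ℝ := Real.exp (-(s v * σ ^ 2)) *
    ∏ i ∈ Finset.Icc 2 K, 1 / (1 + s v * dist v i ^ (-η))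
  have hW : Measurable W := by fun_prop
  have hW_past : ∀ ω, W (past ω) = dominantFactor x η σ T K ω := fun ω => by
    simp only [W, hs_past, dominantFactor]
    congr 1
    exact Finset.prod_congr rfl fun i hi => by
      rw [hdist_past ω i (Finset.mem_Icc.1 hi).2]
      rfl
  let R (p : (Iic K → ℝ) × ℝ) : ℝ := √(dist p.1 K ^ 2 + p.2 / (lam * Real.pi))
  have hR : Measurable R := by
    have := hdist K
    fun_prop
  let φ (p : (Iic K → ℝ) × ℝ) : ℝ≥0∞ := ENNReal.ofReal (W p.1) *
    ENNReal.ofReal (1 / (1 + s p.1 * R p ^ (-η)) * Real.exp (-tailMass lam η (s p.1) (R p)))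
  have hφ : Measurable φ := by
    have hm : Measurable fun p : (Iic K → ℝ) × ℝ => tailMass lam η (s p.1) (R p) :=
      measurable_tailMass_uncurry.comp ((hs.comp measurable_fst).prodMk hR)
    fun_prop
  have hcalc := lintegral_eq_of_map_eq_prod
    (measurable_pi_lambda past fun i => hx.measurable_discMass _)
    ((hx.measurable_discMass (K + 1)).sub (hx.measurable_discMass K))
    (map_past_gap_eq_prod hlam hΦ hx K) hφ
  have hleft : ∀ ω, ENNReal.ofReal (conditionalCoverage x lam η σ T (K + 1) ω) =
      φ (past ω, discMass lam (x (K + 1) ω) - discMass lam (x K ω)) := by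
    intro ω
    have hRω : R (past ω, discMass lam (x (K + 1) ω) - discMass lam (x K ω)) =
        ‖x (K + 1) ω‖ := by
      simp only [R, hdist_past ω K le_rfl]
      rw [← sqrt_discMass_div hlam (x (K + 1) ω)]
      congr 1
      simp only [discMass]
      field_simp
      ring
    have hnot : K + 1 ∉ Finset.Icc 2 K := fun h =>
      absurd (Finset.mem_Icc.1 h).2 (not_le.2 (PNat.lt_add_right K 1))
    simp only [φ, hRω, hs_past, hW_past]
    rw [← ENNReal.ofReal_mul (dominantFactor_nonneg hT.le K ω), conditionalCoverage,
      dominantFactor, dominantFactor, pnat_Icc_two_add_one, Finset.prod_insert hnot]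
    congr 1
    simp only [bsDist]
    ring
  simp_rw [hleft]
  refine hcalc.trans (lintegral_congr_ae ?_)
  filter_upwards [hx.ae_norm_pos hΦ hlam.le] with ω hpos
  simp only [φ]
  rw [lintegral_const_mul' _ _ ENNReal.ofReal_ne_top]
  simp only [R]
  rw [hdist_past ω K le_rfl, hs_past, hW_past,
    lintegral_exp_neg_tailMass_step hlam hη (sVar_nonneg hT.le ω) (hpos K),
    ← ENNReal.ofReal_mul (dominantFactor_nonneg hT.le K ω)]
  rfl

theorem integral_conditionalCoverage_eq_first (hlam : 0 < lam) (hη : 2 < η) (hT : 0 < T)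
    (hΦ : IsHomogeneousPPP μ lam Φ) (hx : IsNearestEnumeration μ Φ x) (K : ℕ+) :
    ∫ ω, conditionalCoverage x lam η σ T K ω ∂μ =
      ∫ ω, conditionalCoverage x lam η σ T 1 ω ∂μ := by
  induction K using PNat.recOn with
  | one => rfl
  | succ K ih =>
    rw [← ih, integral_eq_lintegral_of_nonneg_ae
        (ae_of_all _ fun ω => conditionalCoverage_nonneg hT.le _ ω)
        (measurable_conditionalCoverage hx.measurable _).aestronglyMeasurable,
      lintegral_conditionalCoverage_add_one hlam hη hT hΦ hx, ← integral_eq_lintegral_of_nonneg_ae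
        (ae_of_all _ fun ω => conditionalCoverage_nonneg hT.le _ ω)
        (measurable_conditionalCoverage hx.measurable _).aestronglyMeasurable]

/-- The coverage probability is the expected conditional coverage given the `K` nearest base
stations. -/
theorem coverageSG_eq_integral {g : ℕ+ → Ω → ℝ} (hlam : 0 < lam) (hη : 2 < η) (hσ : 0 < σ)
    (hT : 0 < T) (hΦ : IsHomogeneousPPP μ lam Φ) (hx : IsNearestEnumeration μ Φ x)
    (hg : IsRayleighFading μ x g) (K : ℕ+) :
    coverageSG μ x g η σ T = ∫ ω, conditionalCoverage x lam η σ T K ω ∂μ := by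
  have hxm := hx.measurable
  have hpos := hx.ae_norm_pos hΦ hlam.le
  have h1 : Tendsto (fun n => ∫ ω, dominantFactor x η σ T n ω ∂μ) atTop
      (𝓝 (coverageSG μ x g η σ T)) := by
    refine ((ENNReal.tendsto_toReal (measure_ne_top _ _)).comp
      (tendsto_lintegral_dominantFactor hg hxm (hpos.mono fun ω h => h 1) hσ hT)).congr fun n => ?_
    exact (integral_eq_lintegral_of_nonneg_ae
      (ae_of_all _ fun ω => dominantFactor_nonneg hT.le _ ω)
      (measurable_dominantFactor hxm _).aestronglyMeasurable).symm
  -- The difference is D_n (1 - exp(-M_n)) ≤ 1 - exp(-M_n), which vanishes because R_n tends to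
  -- infinity.
  have h2 : Tendsto (fun n => ∫ ω, (dominantFactor x η σ T n ω -
      conditionalCoverage x lam η σ T n ω) ∂μ) atTop (𝓝 (∫ _, (0 : ℝ) ∂μ)) := by
    refine tendsto_integral_filter_of_dominated_convergence (fun _ => 1)
      (Eventually.of_forall fun n => ((measurable_dominantFactor hxm n).sub
        (measurable_conditionalCoverage hxm n)).aestronglyMeasurable)
      (Eventually.of_forall fun n => ae_of_all _ fun ω => ?_) (integrable_const _) ?_
    · have := dominantFactor_le_one (x := x) (η := η) (σ := σ) hT.le n ω
      have := dominantFactor_nonneg (x := x) (η := η) (σ := σ) hT.le n ω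
      have := conditionalCoverage_le_one (x := x) (η := η) (σ := σ) hlam.le hT.le n ω
      have := conditionalCoverage_nonneg (lam := lam) (x := x) (η := η) (σ := σ) hT.le n ω
      rw [Real.norm_eq_abs, abs_le]
      constructor <;> linarith
    · filter_upwards [hx.ae_tendsto_norm_atTop hΦ] with ω hω
      have h3 := (tendsto_tailMass_atTop (lam := lam) hη
        (sVar_nonneg (x := x) (η := η) hT.le ω)).comp hω
      have h4 : Tendsto (fun n => 1 - Real.exp (-tailMass lam η (sVar x η T ω) (bsDist x n ω)))
          atTop (𝓝 0) := by
        have h5 := ((Real.continuous_exp.tendsto _).comp h3.neg).const_sub 1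
        simpa [bsDist] using h5
      refine squeeze_zero (fun n => ?_) (fun n => ?_) h4
      · rw [sub_nonneg]
        exact mul_le_of_le_one_right (dominantFactor_nonneg hT.le n ω)
          (exp_neg_tailMass_le_one hlam.le hT.le n ω)
      · rw [conditionalCoverage, ← mul_one_sub]
        exact mul_le_of_le_one_left (sub_nonneg.2 (exp_neg_tailMass_le_one hlam.le hT.le n ω))
          (dominantFactor_le_one hT.le n ω)
  have h6 := h1.sub h2
  rw [integral_zero, sub_zero] at h6
  -- The sequence in `h6` is E[C_n], constant in n by invariance, so its limit is its value at K.
  refine tendsto_nhds_unique h6 (tendsto_const_nhds.congr fun n => ?_)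
  rw [integral_sub (integrable_dominantFactor hT.le hxm n)
      (integrable_conditionalCoverage hlam.le hT.le hxm n), sub_sub_cancel,
    integral_conditionalCoverage_eq_first hlam hη hT hΦ hx K,
    integral_conditionalCoverage_eq_first hlam hη hT hΦ hx n]

end Truncation

/-! ### The truncation bound. -/

theorem theorem1 {Ω : Type*} [MeasurableSpace Ω] (μ : Measure Ω) [IsProbabilityMeasure μ]
    (lam η σ T : ℝ) (hlam : 0 < lam) (hη : 2 < η) (hσ : 0 < σ) (hT : 0 < T)
    (Φ : Ω → Set Plane) (hΦ : IsHomogeneousPPP μ lam Φ)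
    (x : ℕ+ → Ω → Plane) (hx : IsNearestEnumeration μ Φ x)
    (g : ℕ+ → Ω → ℝ) (hg : IsRayleighFading μ x g)
    (K N : ℕ+) (hKN : K ≤ N) :
    (∀ᵐ ω ∂μ, IntegrableOn (tailKernel η (sVar x η T ω)) (Ioi (bsDist x N ω))) ∧
    Integrable (hybridIntegrand x lam η σ T K N) μ ∧
    Integrable (fun ω => tailError lam η (sVar x η T ω) (bsDist x N ω)) μ ∧
    |coverageHybrid μ x lam η σ T K N - coverageSG μ x g η σ T| ≤
      ∫ ω, tailError lam η (sVar x η T ω) (bsDist x N ω) ∂μ := by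
  have hxm := hx.measurable
  have hpos := hx.ae_norm_pos hΦ hlam.le
  let Q (ω : Ω) : ℝ := dominantFactor x η σ T K ω *
    Real.exp (-(tailMass lam η (sVar x η T ω) (bsDist x K ω) -
      tailMass lam η (sVar x η T ω) (bsDist x N ω)))
  have hQm : Measurable Q := (measurable_dominantFactor hxm K).mul
    ((measurable_tailMass_comp hxm K).sub (measurable_tailMass_comp hxm N)).neg.exp
  have hQ : hybridIntegrand x lam η σ T K N =ᵐ[μ] Q := by
    filter_upwards [hpos] with ω h
    exact hybridIntegrand_eq hη hT h
  -- K ≤ N enters here: R_K ≤ R_N makes the exponent nonpositive, hence Q ≤ 1.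
  have hexp : ∀ᵐ ω ∂μ, Real.exp (-(tailMass lam η (sVar x η T ω) (bsDist x K ω) -
      tailMass lam η (sVar x η T ω) (bsDist x N ω))) ≤ 1 := by
    filter_upwards [hpos, hx.strictMono] with ω h hmono
    rw [Real.exp_le_one_iff, neg_nonpos, sub_nonneg]
    exact tailMass_anti hlam.le hη (sVar_nonneg hT.le ω) (h K) (hmono.monotone hKN)
  have hQint : Integrable Q μ := by
    refine Integrable.of_bound hQm.aestronglyMeasurable 1 ?_
    filter_upwards [hexp] with ω h
    rw [Real.norm_of_nonneg (mul_nonneg (dominantFactor_nonneg hT.le K ω) (Real.exp_pos _).le)]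
    exact mul_le_one₀ (dominantFactor_le_one hT.le K ω) (Real.exp_pos _).le h
  have hδ : Integrable (fun ω => tailError lam η (sVar x η T ω) (bsDist x N ω)) μ := by
    simp_rw [tailError_eq]
    refine Integrable.of_bound
      ((measurable_tailMass_comp hxm N).neg.exp.const_sub 1).aestronglyMeasurable 1
      (ae_of_all _ fun ω => ?_)
    have h1 := exp_neg_tailMass_le_one (x := x) (η := η) hlam.le hT.le N ω
    have h2 := Real.exp_pos (-tailMass lam η (sVar x η T ω) (bsDist x N ω))
    rw [Real.norm_eq_abs, abs_le]
    constructor <;> linarith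
  refine ⟨?_, hQint.congr hQ.symm, hδ, ?_⟩
  · filter_upwards [hpos] with ω h
    exact integrableOn_tailKernel hη (sVar_nonneg hT.le ω) (h N)
  · have hC := integrable_conditionalCoverage (μ := μ) (x := x) (η := η) (σ := σ) hlam.le hT.le
      hxm K
    rw [coverageHybrid, integral_congr_ae hQ, coverageSG_eq_integral hlam hη hσ hT hΦ hx hg K,
      ← integral_sub hQint hC]
    refine (abs_integral_le_integral_abs).trans (integral_mono_ae (hQint.sub hC).abs hδ ?_)
    filter_upwards [hexp] with ω h
    -- The conditional coverage at K is Q exp(-M_N), so the difference factors exactly as Q times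
    -- the tail error.
    have hprod : Q ω - conditionalCoverage x lam η σ T K ω =
        (dominantFactor x η σ T K ω * Real.exp (-(tailMass lam η (sVar x η T ω) (bsDist x K ω) -
          tailMass lam η (sVar x η T ω) (bsDist x N ω)))) *
        tailError lam η (sVar x η T ω) (bsDist x N ω) := by
      simp only [Q, conditionalCoverage, tailError_eq]
      rw [mul_one_sub, mul_assoc, ← Real.exp_add]
      congr 3
      ring
    have hδ0 : 0 ≤ tailError lam η (sVar x η T ω) (bsDist x N ω) := by
      rw [tailError_eq, sub_nonneg]
      exact exp_neg_tailMass_le_one hlam.le hT.le N ω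
    have hfac := mul_nonneg (dominantFactor_nonneg (x := x) (η := η) (σ := σ) hT.le K ω)
      (Real.exp_pos (-(tailMass lam η (sVar x η T ω) (bsDist x K ω) -
        tailMass lam η (sVar x η T ω) (bsDist x N ω)))).le
    refine le_of_eq_of_le (congrArg abs hprod) ?_
    rw [ abs_of_nonneg (mul_nonneg hfac hδ0)]
    exact mul_le_of_le_one_left hδ0
      (mul_le_one₀ (dominantFactor_le_one hT.le K ω) (Real.exp_pos _).le h)
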